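/- Let $N\ge 0$ and $K\ge 1$ be integers. Let $A=C(S^{N-1}_{\mathbb C,K})$ be the universal unital $C^*$-algebra generated by $z_1,\dots,z_N$ subject to $$\sum_i z_iz_i^*=\sum_i z_i^*z_i=1,\qquad [z_{i_1}\cdots z_{i_K},z_{j_1}\cdots z_{j_K}]=0=[z_{i_1}\cdots z_{i_K},z_{j_1}^*\cdots z_{j_K}^*]$$ for all indices. The group $\mu_K$ of $K$-th roots of unity acts on $A$ by $\omega\cdot z_i=\omega z_i$; put $A_l=\{a\in A:\ \omega\cdot a=\omega^l a\ \ \forall \omega\in\mu_K\}$ and $\gamma(a)=\sum_i z_iaz_i^*$. A subspace $X\subset S^{N-1}_{\mathbb C,K}$ is a unital $C^*$-algebra $C(X)$ with a surjective morphism $q:A\to C(X)$; it is $K$-symmetric if the $\mu_K$-action on $A$ induces a $\mu_K$-action on $C(X)$. Let $S^{N-1}_{\mathbb C}$ be the unit sphere of $\mathbb C^N$. Let $\mathbb Z_K=\langle\tau\rangle$ act on $(S^{N-1}_{\mathbb C})^K$ by $\tau(z_0,\dots,z_{K-1})=(z_{K-1},z_0,\dots,z_{K-2})$, and on the compact set $\mathcal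 P_u$ of norm one pure tensors in $(\mathbb C^N)^{\otimes K}$ by cyclic permutation of the tensor factors; a subset of either space is symmetric if it is stable under $\mathbb Z_K$. Let $p:(S^{N-1}_{\mathbb C})^K\to\mathcal P_u$, $p(z_0,\dots,z_{K-1})=z_0\otimes\cdots\otimes z_{K-1}$, let $r_{i_1\dots i_K}$ be the coordinate functions on $\mathcal P_u$, and let $a_{ic}(z_0,\dots,z_{K-1})=(z_c)_i$. For $T\subset (S^{N-1}_{\mathbb C})^K$ symmetric and compact, the induced action on $C(T)$ satisfies $\tau(a_{ic})=a_{i,c+1}$ (second index modulo $K$), and $C(T)\rtimes\mathbb Z_K$ is the corresponding crossed product. **Theorem.** Let $X\subset S^{N-1}_{\mathbb C,K}$ be $K$-symmetric. Then there is an injective $*$-homomorphism $\Phi:C(\mathcal P_u)\to A$ with image $A_0$ such that $\Phi(r_{i_1\dots i_K})=z_{i_1}\cdots z_{i_K}$, and the following hold. 1. There is a $\gamma$-stable ideal $J\subset A_0$ such that $C(X)=A/\langle J\rangle$, that is, $\ker q=\langle J\rangle=J+A_1J+\cdots+A_{K-1}J$. 2. For every such $J$, there is a symmetric compact set $T_0\subset\mathcal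 P_u$ such that $\Phi^{-1}(J)$ is the ideal of functions vanishing on $T_0$; the set $T=p^{-1}(T_0)\subset (S^{N-1}_{\mathbb C})^K$ is symmetric and compact; and there is an injective morphism of $C^*$-algebras $C(X)\to C(T)\rtimes\mathbb Z_K$ that sends the class $q(z_i)$ to $a_{i0}|_T\otimes\tau$ for $i=1,\dots,N$. -/

import Mathlib

open scoped ENNReal

noncomputable section

namespace HalfLib

/-! ### The `C⋆`-algebra of the `K`-half-liberated sphere -/

/-- The word `a_{i_0} a_{i_1} ⋯ a_{i_{m-1}}`. -/
def word {A : Type*} [Monoid A] {N m : ℕ} (a : Fin N → A) (i : Fin m → Fin N) : A :=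
  (List.ofFn fun c => a (i c)).prod

/-- The defining relations of the `K`-half-liberated complex sphere, for an `N`-tuple `a` of
elements of a unital `C⋆`-algebra. -/
structure IsHalfLiberated (K : ℕ) {N : ℕ} {A : Type*} [CStarAlgebra A] (a : Fin N → A) :
    Prop where
  sum_mul_star : ∑ i, a i * star (a i) = 1
  sum_star_mul : ∑ i, star (a i) * a i = 1
  comm : ∀ i j : Fin K → Fin N, word a i * word a j = word a j * word a i
  comm_star : ∀ i j : Fin K → Fin N,
    word a i * word (fun k => star (a k)) j = word (fun k => star (a k)) j * word a i

theorem IsHalfLiberated.norm_le {K N : ℕ} {A : Type*} [CStarAlgebra A] [Nontrivial A]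
    {a : Fin N → A} (h : IsHalfLiberated K a) (i : Fin N) : ‖a i‖ ≤ 1 := by
  let _ := CStarAlgebra.spectralOrder A
  let _ := CStarAlgebra.spectralOrderedRing A
  have h1 : a i * star (a i) ≤ 1 := by
    rw [← h.sum_mul_star]
    exact Finset.single_le_sum (f := fun i => a i * star (a i))
      (fun j _ => mul_star_self_nonneg (a j)) (Finset.mem_univ i)
  have h2 := CStarAlgebra.norm_le_norm_of_nonneg_of_le (mul_star_self_nonneg (a i)) h1
  rw [CStarRing.norm_self_mul_star, norm_one] at h2
  nlinarith [norm_nonneg (a i)]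

/-- A realization of the defining relations in a nonzero `C⋆`-algebra. (Realizations in the zero
algebra contribute nothing to the universal norm. A `C⋆`-algebra generated by `N` elements has at
most continuum many elements, so carriers in `Type` account for all realizations up to
isomorphism.) -/
structure Realization (N K : ℕ) : Type 1 where
  carrier : Type
  [cstar : CStarAlgebra carrier]
  [nontriv : Nontrivial carrier]
  point : Fin N → carrier
  rel : IsHalfLiberated K point

attribute [instance] Realization.cstar Realization.nontriv

/-- The `C⋆`-algebra of bounded families indexed by all realizations. -/
abbrev Families (N K : ℕ) : Type 1 := lp (fun r : Realization N K => r.carrier) ∞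

instance (N K : ℕ) : CStarAlgebra (Families N K) :=
  { lp.inftyNormedRing, lp.inftyStarRing, lp.inftyNormedAlgebra with
    toCompleteSpace := lp.completeSpace
    toCStarRing := lp.inftyCStarRing
    toStarModule := inferInstance }

/-- The universal tuple, whose component at a realization is the tuple of that realization. -/
def univPoint (N K : ℕ) (i : Fin N) : Families N K :=
  ⟨fun r => r.point i, memℓp_infty ⟨1, by rintro _ ⟨r, rfl⟩; exact r.rel.norm_le i⟩⟩

/-- The closed unital `*`-subalgebra generated by the universal tuple. -/
def sphereSubalgebra (N K : ℕ) : StarSubalgebra ℂ (Families N K) :=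
  (StarAlgebra.adjoin ℂ (Set.range (univPoint N K))).topologicalClosure

/-- `C(S^{N-1}_{ℂ,K})`, the universal unital `C⋆`-algebra with generators `z_1, …, z_N` subject to
the relations `IsHalfLiberated K z`: the `*`-algebra generated by the universal tuple, completed
for the norm which is the supremum of the norms over all realizations of the relations. -/
def CSphere (N K : ℕ) : Type 1 := sphereSubalgebra N K

instance (N K : ℕ) : CStarAlgebra (CSphere N K) :=
  StarSubalgebra.cstarAlgebra (sphereSubalgebra N K)
    (h_closed := StarSubalgebra.isClosed_topologicalClosure _)

/-- The canonical generators `z_i` of `C(S^{N-1}_{ℂ,K})`. -/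
def zgen (N K : ℕ) (i : Fin N) : CSphere N K :=
  ⟨univPoint N K i, StarSubalgebra.le_topologicalClosure _
    (StarAlgebra.subset_adjoin ℂ _ ⟨i, rfl⟩)⟩

/-! ### The action of the `K`-th roots of unity and the grading -/

theorem word_smul {A : Type*} [CStarAlgebra A] {N m : ℕ} (a : Fin N → A) (ω : ℂ)
    (i : Fin m → Fin N) : word (fun k => ω • a k) i = ω ^ m • word a i := by
  induction m with
  | zero => simp [word]
  | succ m ih =>
    have h := ih (fun c => i c.succ)
    simp only [word] at h ⊢
    simp only [List.ofFn_succ, List.prod_cons, h, smul_mul_smul_comm]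
    rw [pow_succ']

theorem IsHalfLiberated.smul {K N : ℕ} [NeZero K] {A : Type*} [CStarAlgebra A] {a : Fin N → A}
    (h : IsHalfLiberated K a) (ω : rootsOfUnity K ℂ) :
    IsHalfLiberated K (fun i => ((ω : ℂˣ) : ℂ) • a i) := by
  have hω : (((ω : ℂˣ) : ℂ)) ^ K = 1 := by
    have := (mem_rootsOfUnity' K (ω : ℂˣ)).1 ω.2
    exact this
  have hn : ‖((ω : ℂˣ) : ℂ)‖ = 1 := Complex.norm_eq_one_of_pow_eq_one hω (NeZero.ne K)
  have hc : ((ω : ℂˣ) : ℂ) * star ((ω : ℂˣ) : ℂ) = 1 := by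
    have := Complex.mul_conj' ((ω : ℂˣ) : ℂ)
    rw [hn] at this
    simpa using this
  have hstar : (fun k => star (((ω : ℂˣ) : ℂ) • a k)) =
      fun k => star ((ω : ℂˣ) : ℂ) • star (a k) := by
    funext k; rw [star_smul]
  refine ⟨?_, ?_, ?_, ?_⟩
  · simp only [star_smul, smul_mul_smul_comm, hc, one_smul, h.sum_mul_star]
  · rw [mul_comm] at hc
    simp only [star_smul, smul_mul_smul_comm, hc, one_smul, h.sum_star_mul]
  · intro i j
    rw [word_smul, word_smul, hω, one_smul, one_smul, h.comm]
  · intro i j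
    rw [hstar, word_smul, word_smul, hω, one_smul, smul_mul_assoc, mul_smul_comm, h.comm_star]

/-- Multiplying the tuple of a realization by a `K`-th root of unity. -/
def Realization.rot {N K : ℕ} [NeZero K] (ω : rootsOfUnity K ℂ) (r : Realization N K) :
    Realization N K where
  carrier := r.carrier
  point i := ((ω : ℂˣ) : ℂ) • r.point i
  rel := r.rel.smul ω

/-- The `*`-endomorphism `f ↦ (r ↦ f (ω · r))` of the algebra of bounded families. -/
def familiesRot {N K : ℕ} [NeZero K] (ω : rootsOfUnity K ℂ) :
    Families N K →⋆ₐ[ℂ] Families N K where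
  toFun f := ⟨fun r => f (r.rot ω), memℓp_infty ⟨‖f‖, by
    rintro _ ⟨r, rfl⟩; exact lp.norm_apply_le_norm (by simp) f (r.rot ω)⟩⟩
  map_one' := rfl
  map_mul' _ _ := rfl
  map_zero' := rfl
  map_add' _ _ := rfl
  commutes' _ := rfl
  map_star' _ := rfl

theorem familiesRot_univPoint {N K : ℕ} [NeZero K] (ω : rootsOfUnity K ℂ) (i : Fin N) :
    familiesRot ω (univPoint N K i) = ((ω : ℂˣ) : ℂ) • univPoint N K i := rfl

theorem familiesRot_mem {N K : ℕ} [NeZero K] (ω : rootsOfUnity K ℂ) (f : Families N K)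
    (hf : f ∈ sphereSubalgebra N K) : familiesRot ω f ∈ sphereSubalgebra N K := by
  have hcont : Continuous (familiesRot (N := N) ω) :=
    AddMonoidHomClass.continuous_of_bound (familiesRot (N := N) ω) 1 fun f => by
      rw [one_mul]
      exact lp.norm_le_of_forall_le (norm_nonneg f) fun r =>
        lp.norm_apply_le_norm (by simp) f (r.rot ω)
  have h1 : (StarAlgebra.adjoin ℂ (Set.range (univPoint N K))) ≤
      (sphereSubalgebra N K).comap (familiesRot ω) := by
    rw [StarAlgebra.adjoin_le_iff]
    rintro _ ⟨i, rfl⟩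
    change familiesRot ω (univPoint N K i) ∈ sphereSubalgebra N K
    rw [familiesRot_univPoint]
    exact (sphereSubalgebra N K).smul_mem (StarSubalgebra.le_topologicalClosure _
      (StarAlgebra.subset_adjoin ℂ _ ⟨i, rfl⟩)) _
  exact StarSubalgebra.topologicalClosure_minimal h1
    ((StarSubalgebra.isClosed_topologicalClosure _).preimage hcont) hf

/-- The `μ_K`-action on `C(S^{N-1}_{ℂ,K})`: the `*`-endomorphism with `z_i ↦ ω z_i`. -/
def rotation {N K : ℕ} [NeZero K] (ω : rootsOfUnity K ℂ) : CSphere N K →⋆ₐ[ℂ] CSphere N K where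
  toFun f := ⟨familiesRot ω f.1, familiesRot_mem ω f.1 f.2⟩
  map_one' := rfl
  map_mul' _ _ := rfl
  map_zero' := rfl
  map_add' _ _ := rfl
  commutes' _ := rfl
  map_star' _ := rfl

theorem rotation_zgen {N K : ℕ} [NeZero K] (ω : rootsOfUnity K ℂ) (i : Fin N) :
    rotation ω (zgen N K i) = ((ω : ℂˣ) : ℂ) • zgen N K i := rfl

/-- The component `C(S^{N-1}_{ℂ,K})_l = {a | ω · a = ω ^ l a for all ω ∈ μ_K}`. -/
def gradedPart (N K : ℕ) [NeZero K] (l : ℕ) : Submodule ℂ (CSphere N K) where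
  carrier := {a | ∀ ω : rootsOfUnity K ℂ, rotation ω a = ((ω : ℂˣ) : ℂ) ^ l • a}
  add_mem' ha hb ω := by rw [map_add, ha ω, hb ω, smul_add]
  zero_mem' ω := by rw [map_zero, smul_zero]
  smul_mem' c a ha ω := by rw [map_smul, ha ω, smul_comm]

/-- The map `γ(a) = ∑ z_i a z_i^*`. -/
def gammaMap {N K : ℕ} (a : CSphere N K) : CSphere N K :=
  ∑ i, zgen N K i * a * star (zgen N K i)

/-! ### Subspaces of the `K`-half-liberated sphere

A (noncommutative closed) subspace `X ⊂ S^{N-1}_{ℂ,K}` is a unital `C⋆`-algebra `B = C(X)` together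
with a surjective morphism `q : C(S^{N-1}_{ℂ,K}) → C(X)`. -/

/-- `X` is `K`-symmetric: the `μ_K`-action induces a `μ_K`-action on `C(X)`. -/
def IsKSymmetric {N K : ℕ} [NeZero K] {B : Type*} [CStarAlgebra B]
    (q : CSphere N K →⋆ₐ[ℂ] B) : Prop :=
  ∃ α : rootsOfUnity K ℂ →* (B →⋆ₐ[ℂ] B), ∀ ω a, α ω (q a) = q (rotation ω a)

/-- `J` is a `γ`-stable ideal of the degree zero part `C(S^{N-1}_{ℂ,K})_0`. -/
structure IsGammaStableIdeal {N K : ℕ} [NeZero K] (J : Submodule ℂ (CSphere N K)) : Prop where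
  le : J ≤ gradedPart N K 0
  mul_mem_left : ∀ a ∈ gradedPart N K 0, ∀ b ∈ J, a * b ∈ J
  mul_mem_right : ∀ a ∈ gradedPart N K 0, ∀ b ∈ J, b * a ∈ J
  gamma_mem : ∀ b ∈ J, gammaMap b ∈ J

/-- `C(X) = C(S^{N-1}_{ℂ,K}) / ⟨J⟩` with `J` a `γ`-stable ideal of the degree zero part and
`⟨J⟩ = J + C(S^{N-1}_{ℂ,K})_1 J + ⋯ + C(S^{N-1}_{ℂ,K})_{K-1} J`. -/
structure IsCutOutBy {N K : ℕ} [NeZero K] {B : Type*} [CStarAlgebra B]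
    (q : CSphere N K →⋆ₐ[ℂ] B) (J : Submodule ℂ (CSphere N K)) : Prop where
  ideal : IsGammaStableIdeal J
  ker_eq_span : TwoSidedIdeal.ker q = TwoSidedIdeal.span (J : Set (CSphere N K))
  mem_ker_iff : ∀ a, q a = 0 ↔ a ∈ J ⊔ ⨆ l ∈ Finset.Ico 1 K, gradedPart N K l * J

/-! ### Products of spheres and pure tensors -/

/-- `(S^{N-1}_ℂ)^K`, with factors indexed by `ZMod K`. -/
abbrev SphereProd (N K : ℕ) : Type := ZMod K → Metric.sphere (0 : EuclideanSpace ℂ (Fin N)) 1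

/-- The action of `j = τ ^ j` on `(S^{N-1}_ℂ)^K`; for `j = 1` it is
`τ (z_0, …, z_{K-1}) = (z_{K-1}, z_0, …, z_{K-2})`. -/
def shift {N K : ℕ} (j : ZMod K) (z : SphereProd N K) : SphereProd N K := fun c => z (c - j)

theorem continuous_shift {N K : ℕ} (j : ZMod K) : Continuous (shift (N := N) j) :=
  continuous_pi fun c => continuous_apply (c - j)

/-- `(ℂ^N)^{⊗ K}` with its Hilbert space structure, in coordinates with respect to the orthonormal
basis `e_{i_0} ⊗ ⋯ ⊗ e_{i_{K-1}}`. -/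
abbrev TensorPower (N K : ℕ) [NeZero K] : Type := EuclideanSpace ℂ (ZMod K → Fin N)

/-- The tensor `v_0 ⊗ ⋯ ⊗ v_{K-1}`. -/
def tensor {N K : ℕ} [NeZero K] (v : ZMod K → EuclideanSpace ℂ (Fin N)) : TensorPower N K :=
  WithLp.toLp 2 fun i => ∏ c, v c (i c)

/-- `P_u((ℂ^N)^{⊗ K})`: the pure tensors of norm one. -/
def pureTensors (N K : ℕ) [NeZero K] : Set (TensorPower N K) :=
  {r | ‖r‖ = 1 ∧ ∃ v : ZMod K → EuclideanSpace ℂ (Fin N), (∀ c, v c ≠ 0) ∧ r = tensor v}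

/-- The coordinate function `r_{i_0 … i_{K-1}}` on the space of pure tensors of norm one. -/
def rcoord {N K : ℕ} [NeZero K] (i : ZMod K → Fin N) : C(pureTensors N K, ℂ) where
  toFun r := r.1 i
  continuous_toFun := (PiLp.continuous_apply 2 (fun _ => ℂ) i).comp continuous_subtype_val

theorem norm_tensor {N K : ℕ} [NeZero K] (v : ZMod K → EuclideanSpace ℂ (Fin N)) :
    ‖tensor v‖ = ∏ c, ‖v c‖ := by
  have h : ‖tensor v‖ ^ 2 = (∏ c, ‖v c‖) ^ 2 := by
    rw [EuclideanSpace.norm_sq_eq, ← Finset.prod_pow]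
    simp only [EuclideanSpace.norm_sq_eq, Finset.prod_univ_sum, Fintype.piFinset_univ, tensor,
      norm_prod, Finset.prod_pow]
  exact (pow_left_inj₀ (norm_nonneg _) (Finset.prod_nonneg fun _ _ => norm_nonneg _)
    two_ne_zero).1 h

/-- The canonical map `p : (z_0, …, z_{K-1}) ↦ z_0 ⊗ ⋯ ⊗ z_{K-1}`. -/
def pureMap {N K : ℕ} [NeZero K] (z : SphereProd N K) : pureTensors N K :=
  ⟨tensor fun c => (z c : EuclideanSpace ℂ (Fin N)), by
    refine ⟨?_, _, fun c => ?_, rfl⟩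
    · rw [norm_tensor]
      exact Finset.prod_eq_one fun c _ => by simp
    · exact ne_zero_of_mem_unit_sphere (z c)⟩

/-- The cyclic permutation `v_0 ⊗ ⋯ ⊗ v_{K-1} ↦ v_{K-1} ⊗ v_0 ⊗ ⋯ ⊗ v_{K-2}` of the tensor
factors. -/
def cyc {N K : ℕ} [NeZero K] (r : TensorPower N K) : TensorPower N K :=
  WithLp.toLp 2 fun i => r fun c => i (c + 1)

theorem cyc_tensor {N K : ℕ} [NeZero K] (v : ZMod K → EuclideanSpace ℂ (Fin N)) :
    cyc (tensor v) = tensor fun c => v (c - 1) := by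
  ext i
  simp only [cyc, tensor]
  exact Fintype.prod_equiv (Equiv.addRight 1) _ _ fun c => by simp

/-- A set of norm one pure tensors is symmetric if it is stable under cyclic permutation of the
tensor factors. -/
def IsSymmetricTensorSet {N K : ℕ} [NeZero K] (S : Set (pureTensors N K)) : Prop :=
  ∀ r ∈ S, ∀ s : pureTensors N K, (s : TensorPower N K) = cyc r → s ∈ S

/-- Symmetric compact subspaces of `(S^{N-1}_ℂ)^K`. -/
structure SymmetricCompact (N K : ℕ) where
  carrier : Set (SphereProd N K)
  isCompact : IsCompact carrier
  shift_mem : ∀ (j : ZMod K), ∀ z ∈ carrier, shift j z ∈ carrier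

instance {N K : ℕ} (T : SymmetricCompact N K) : CompactSpace T.carrier :=
  isCompact_iff_compactSpace.1 T.isCompact

/-- The action of `ℤ_K` on `C(T)`, `(τ ^ j f)(z) = f(τ ^ (-j) z)`, so that
`τ(a_{i,c}) = a_{i,c+1}`. -/
def SymmetricCompact.action {N K : ℕ} (T : SymmetricCompact N K) :
    Multiplicative (ZMod K) →* (C(T.carrier, ℂ) →⋆ₐ[ℂ] C(T.carrier, ℂ)) where
  toFun j := ContinuousMap.compStarAlgHom' ℂ ℂ
    ⟨fun z => ⟨shift (-j.toAdd) z.1, T.shift_mem _ _ z.2⟩,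
      ((continuous_shift (-j.toAdd)).comp continuous_subtype_val).subtype_mk _⟩
  map_one' := by
    ext f z
    change f _ = f z
    congr 1
    refine Subtype.ext (funext fun c => ?_)
    change z.1 (c - -0) = z.1 c
    rw [neg_zero, sub_zero]
  map_mul' j k := by
    ext f z
    change f _ = f _
    congr 1
    refine Subtype.ext (funext fun c => ?_)
    change z.1 (c - -(j.toAdd + k.toAdd)) = z.1 (c - -k.toAdd - -j.toAdd)
    exact congrArg z.1 (by abel)

/-- The coordinate function `a_{i,c} : z ↦ (z_c)_i`, restricted to `T`. -/
def SymmetricCompact.acoord {N K : ℕ} (T : SymmetricCompact N K) (i : Fin N) (c : ZMod K) :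
    C(T.carrier, ℂ) where
  toFun z := (z.1 c : EuclideanSpace ℂ (Fin N)) i
  continuous_toFun :=
    (PiLp.continuous_apply 2 (fun _ : Fin N => ℂ) i).comp
      (continuous_subtype_val.comp ((continuous_apply c).comp continuous_subtype_val))

end HalfLib

/-! ### Crossed products by finite groups -/

/-- The crossed product `A ⋊ G` of an algebra by a finite group: formal sums `∑ a_g ⊗ g`, encoded
by the function `g ↦ a_g`. -/
def CrossedProduct {G A : Type*} [Group G] [Semiring A] [StarRing A] [Algebra ℂ A]
    (_α : G →* (A →⋆ₐ[ℂ] A)) : Type _ := G → A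

namespace CrossedProduct

variable {G A : Type*} [Group G] [Fintype G] [DecidableEq G]

section algebraic

set_option linter.unusedSectionVars false

variable [Ring A] [StarRing A] [Algebra ℂ A] [StarModule ℂ A] (α : G →* (A →⋆ₐ[ℂ] A))

instance : AddCommGroup (CrossedProduct α) := inferInstanceAs (AddCommGroup (G → A))

instance : Module ℂ (CrossedProduct α) := inferInstanceAs (Module ℂ (G → A))

/-- The element `a ⊗ g`. -/
def tmul (a : A) (g : G) : CrossedProduct α := Pi.single g a

/-- `(a ⊗ s) (b ⊗ t) = a α_s(b) ⊗ s t`. -/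
instance : Mul (CrossedProduct α) := ⟨fun f g s => ∑ t, f t * α t (g (t⁻¹ * s))⟩

/-- `1 ⊗ 1`. -/
instance : One (CrossedProduct α) := ⟨tmul α 1 1⟩

/-- `(a ⊗ s)^* = α_{s⁻¹}(a^*) ⊗ s⁻¹`. -/
instance : Star (CrossedProduct α) := ⟨fun f s => α s (star (f s⁻¹))⟩

variable {α}

theorem add_apply (f g : CrossedProduct α) (s : G) : (f + g) s = f s + g s := rfl

theorem smul_apply (c : ℂ) (f : CrossedProduct α) (s : G) : (c • f) s = c • f s := rfl

theorem mul_apply (f g : CrossedProduct α) (s : G) :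
    (f * g) s = ∑ t, f t * α t (g (t⁻¹ * s)) := rfl

theorem one_apply (s : G) : (1 : CrossedProduct α) s = if s = 1 then 1 else 0 :=
  Pi.single_apply 1 1 s

theorem star_apply (f : CrossedProduct α) (s : G) : (star f) s = α s (star (f s⁻¹)) := rfl

theorem act_act (s t : G) (a : A) : α s (α t a) = α (s * t) a := by
  rw [map_mul]; rfl

theorem act_one (a : A) : α 1 a = a := by rw [map_one]; rfl

/-- The regular representation of the crossed product by matrices over `A`. -/
def regFun (f : CrossedProduct α) : CStarMatrix G G A :=
  CStarMatrix.ofMatrix fun s t => α s⁻¹ (f (s * t⁻¹))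

theorem regFun_apply (f : CrossedProduct α) (s t : G) :
    regFun f s t = α s⁻¹ (f (s * t⁻¹)) := rfl

theorem regFun_injective : Function.Injective (regFun (α := α)) := by
  intro f g h
  funext s
  have h1 : regFun f s 1 = regFun g s 1 := by rw [h]
  rw [regFun_apply, regFun_apply] at h1
  have h2 := congrArg (α s) h1
  rwa [inv_one, mul_one, act_act, act_act, mul_inv_cancel, act_one, act_one] at h2

theorem regFun_add (f g : CrossedProduct α) : regFun (f + g) = regFun f + regFun g := by
  ext s t
  simp [regFun_apply, add_apply]

theorem regFun_mul (f g : CrossedProduct α) : regFun (f * g) = regFun f * regFun g := by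
  ext s t
  rw [CStarMatrix.mul_apply]
  simp only [regFun_apply, mul_apply, map_sum, map_mul, act_act]
  refine Fintype.sum_equiv ((Equiv.inv G).trans (Equiv.mulRight s)) _ _ fun u => ?_
  simp [mul_assoc]

theorem regFun_one : regFun (1 : CrossedProduct α) = 1 := by
  ext s t
  rw [regFun_apply, one_apply, CStarMatrix.one_apply]
  by_cases h : s = t
  · simp [h]
  · simp [h, mul_inv_eq_one]

theorem regFun_smul (c : ℂ) (f : CrossedProduct α) : regFun (c • f) = c • regFun f := by
  ext s t
  simp [regFun_apply, smul_apply]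

theorem regFun_star (f : CrossedProduct α) : regFun (star f) = star (regFun f) := by
  ext s t
  rw [CStarMatrix.star_apply]
  simp only [regFun_apply, star_apply, act_act, ← map_star]
  simp

instance : Ring (CrossedProduct α) :=
  { (inferInstance : AddCommGroup (CrossedProduct α)) with
    mul := (· * ·)
    one := 1
    left_distrib := fun f g h => regFun_injective (by
      simp only [regFun_mul, regFun_add, mul_add])
    right_distrib := fun f g h => regFun_injective (by
      simp only [regFun_mul, regFun_add, add_mul])
    zero_mul := fun f => by
      funext s
      simp only [mul_apply]
      exact Finset.sum_eq_zero fun t _ => zero_mul _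
    mul_zero := fun f => by
      funext s
      simp only [mul_apply]
      exact Finset.sum_eq_zero fun t _ => by
        change _ * α t 0 = 0
        simp
    mul_assoc := fun f g h => regFun_injective (by simp only [regFun_mul, mul_assoc])
    one_mul := fun f => regFun_injective (by simp only [regFun_mul, regFun_one, one_mul])
    mul_one := fun f => regFun_injective (by simp only [regFun_mul, regFun_one, mul_one]) }

instance : Algebra ℂ (CrossedProduct α) :=
  Algebra.ofModule
    (fun c f g => regFun_injective (by simp only [regFun_mul, regFun_smul, smul_mul_assoc]))
    (fun c f g => regFun_injective (by simp only [regFun_mul, regFun_smul, mul_smul_comm]))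

instance : StarRing (CrossedProduct α) where
  star_involutive f := regFun_injective (by simp only [regFun_star, star_star])
  star_mul f g := regFun_injective (by simp only [regFun_star, regFun_mul, star_mul])
  star_add f g := regFun_injective (by simp only [regFun_star, regFun_add, star_add])

instance : StarModule ℂ (CrossedProduct α) where
  star_smul c f := regFun_injective (by simp only [regFun_star, regFun_smul, star_smul])

variable (α) in
/-- The regular representation as a `*`-homomorphism. -/
def regular : CrossedProduct α →⋆ₐ[ℂ] CStarMatrix G G A :=
  { toFun := regFun
    map_one' := regFun_one
    map_mul' := regFun_mul
    map_zero' := by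
      ext s t
      change α s⁻¹ 0 = 0
      simp
    map_add' := regFun_add
    commutes' := fun c => by
      rw [Algebra.algebraMap_eq_smul_one, Algebra.algebraMap_eq_smul_one]
      exact (regFun_smul c 1).trans (by rw [regFun_one])
    map_star' := regFun_star }

end algebraic

section cstar

variable [CStarAlgebra A] (α : G →* (A →⋆ₐ[ℂ] A))

/-- The crossed product of a `C⋆`-algebra by a finite group is a `C⋆`-algebra; its norm is the one
of the (faithful) regular representation. -/
instance : CStarAlgebra (CrossedProduct α) :=
  letI : PartialOrder A := CStarAlgebra.spectralOrder A
  letI : StarOrderedRing A := CStarAlgebra.spectralOrderedRing A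
  letI n : NormedRing (CrossedProduct α) :=
    NormedRing.induced _ (CStarMatrix G G A) (regular α) regFun_injective
  have hnorm : ∀ f : CrossedProduct α, ‖f‖ = ‖regular α f‖ := fun _ => rfl
  have hiso : Isometry (regular α) := fun f g => rfl
  { n with
    toStarRing := inferInstance
    toAlgebra := inferInstance
    complete := by
      have hr : Set.range (regular α) = {M : CStarMatrix G G A | ∀ s t,
          M s t = α s⁻¹ (α (s * t⁻¹) (M (s * t⁻¹) 1))} := by
        ext M
        constructor
        · rintro ⟨f, rfl⟩ s t
          change regFun f s t = α s⁻¹ (α (s * t⁻¹) (regFun f (s * t⁻¹) 1))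
          simp only [regFun_apply, act_act, inv_one, mul_one, mul_inv_cancel]
        · intro h
          refine ⟨fun u => α u (M u 1), ?_⟩
          ext s t
          change α s⁻¹ (α (s * t⁻¹) (M (s * t⁻¹) 1)) = M s t
          exact (h s t).symm
      have hentry : ∀ s t : G, Continuous fun M : CStarMatrix G G A => M s t := fun s t =>
        (continuous_apply t).comp (continuous_apply s)
      have hcl : IsClosed (Set.range (regular α)) := by
        rw [hr]
        simp only [Set.ofPred_forall]
        refine isClosed_iInter fun s => isClosed_iInter fun t => ?_
        exact isClosed_eq (hentry s t) ((map_continuous (α s⁻¹)).comp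
          ((map_continuous (α (s * t⁻¹))).comp (hentry _ _)))
      intro F hF
      exact ((completeSpace_iff_isComplete_range hiso.isUniformInducing).2
        hcl.isComplete).complete hF
    norm_mul_self_le := fun f => by
      rw [hnorm, hnorm (star f * f), map_mul, map_star, CStarRing.norm_star_mul_self]
    norm_smul_le := fun c f => by
      rw [hnorm, hnorm f, map_smul]
      exact norm_smul_le c _
    star_smul := star_smul }

end cstar

end CrossedProduct

end

noncomputable section

namespace HalfLib

/-! ### Words and spans of words -/

section words

variable {N K : ℕ} {A : Type*} [CStarAlgebra A] {z : Fin N → A}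

/-! Write Z and S for the spans of the z_i and of the z_i^*, and W for the closed *-algebra
generated by the words of length K. The sphere relations say 1 ∈ ZS and 1 ∈ SZ, hence 1 ∈ Z^m S^m
and 1 ∈ S^m Z^m. Inserting these units shows that ZS, SZ and SWZ lie in W, that WZ ⊆ ZW, and that W
+ ZW + ⋯ + Z^{K-1}W is stable under left multiplication by every z_i and z_i^*. It therefore
contains the dense *-algebra generated by the z_i. Averaging over μ_K kills Z^l W for 0 < l < K, so
A_0 = W (`mem_wordAlg_iff`), and the defining relations make W commutative.

Commutativity of W forces z_i x z_j = z_j x z_i for x ∈ Z^{K-1} (`exchange`). So the values of a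
character of W on the words form a norm one tensor whose indices can be exchanged factor by factor,
and such a tensor is pure (`mem_pureTensors_of_exchange`). Gelfand duality turns this into Φ :
C(P_u) → A with image in A_0. The elements a_{i0} ⊗ τ satisfy the defining relations, which gives a
representation of A in C(T) ⋊ ℤ_K for every symmetric compact T; it sends Φ(f) to (f ∘ p) ⊗ 1.
Taking T to be the whole product of spheres, where p is onto, gives injectivity of Φ.

For the ideals, the unit 1 ∈ Z^l S^l moves an element a of A_l into Z^l (S^l a) with S^l a ⊆ A_0.
Hence a kernel stable under the projections onto the A_l is generated by its degree zero part J, and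
J is unique. The kernel of q is stable by K-symmetry; the kernel of the representation is stable
because A_l goes to the fibre over τ^l. Under the representation γ becomes τ acting on C(T), so
γ-stability of J makes the zero set T_0 symmetric. For T = p^{-1}(T_0) the representation has degree
zero kernel J, thus the same kernel as q, and factors through an injection of C(X). -/

theorem word_succ {A : Type*} [Monoid A] {N m : ℕ} (a : Fin N → A) (i : Fin (m + 1) → Fin N) :
    word a i = a (i 0) * word a (fun c => i c.succ) := by
  simp [word, List.ofFn_succ]

theorem word_succ' {A : Type*} [Monoid A] {N m : ℕ} (a : Fin N → A) (i : Fin (m + 1) → Fin N) :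
    word a i = word a (fun c => i c.castSucc) * a (i (Fin.last m)) := by
  rw [word, List.ofFn_succ', List.concat_eq_append, List.prod_append]
  simp [word]

/-- The adjoint reverses words, so `comm_star`, quantified over all indices, also says that words
commute with adjoints of words. -/
theorem word_star {A : Type*} [Monoid A] [StarMul A] {N m : ℕ} (a : Fin N → A)
    (i : Fin m → Fin N) :
    word (fun k => star (a k)) i = star (word a fun c => i c.rev) := by
  induction m with
  | zero => simp [word]
  | succ m ih =>
    rw [word_succ, ih, word_succ', star_mul]
    simp [Fin.rev_castSucc]

theorem sum_word_mul_star (h : IsHalfLiberated K z) (m : ℕ) :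
    ∑ i : Fin m → Fin N, word z i * star (word z i) = 1 := by
  induction m with
  | zero => simp [word]
  | succ m ih =>
    rw [← (Fin.consEquiv fun _ => Fin N).sum_comp, Fintype.sum_prod_type]
    calc _ = ∑ k, z k * (∑ i : Fin m → Fin N, word z i * star (word z i)) * star (z k) := by
          refine Finset.sum_congr rfl fun k _ => ?_
          rw [Finset.mul_sum, Finset.sum_mul]
          refine Finset.sum_congr rfl fun i _ => ?_
          simp [word_succ, Fin.consEquiv, mul_assoc]
      _ = 1 := by simp [ih, h.sum_mul_star]

/-- The linear span of a tuple. -/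
def genSpan (z : Fin N → A) : Submodule ℂ A := Submodule.span ℂ (Set.range z)

theorem mem_genSpan (z : Fin N → A) (i : Fin N) : z i ∈ genSpan z :=
  Submodule.subset_span ⟨i, rfl⟩

theorem genSpan_pow (z : Fin N → A) (m : ℕ) :
    genSpan z ^ m = Submodule.span ℂ (Set.range (word z : (Fin m → Fin N) → A)) := by
  rw [genSpan, Submodule.span_pow]
  congr 1
  ext a
  rw [Set.mem_pow]
  constructor
  · rintro ⟨f, rfl⟩
    choose g hg using fun c => (f c).2
    exact ⟨g, by simp [word, hg]⟩
  · rintro ⟨i, rfl⟩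
    exact ⟨fun c => ⟨z (i c), i c, rfl⟩, rfl⟩

/-- The sphere relation as an inclusion of subspaces. All later insertions of a unit use this form,
which avoids explicit sums over words. -/
theorem one_le_genSpan_mul (h : IsHalfLiberated K z) :
    1 ≤ genSpan z * genSpan (fun k => star (z k)) := by
  rw [Submodule.one_le, ← h.sum_mul_star]
  exact Submodule.sum_mem _ fun i _ => Submodule.mul_mem_mul (mem_genSpan z i)
    (mem_genSpan (fun k => star (z k)) i)

theorem one_le_star_genSpan_mul (h : IsHalfLiberated K z) :
    1 ≤ genSpan (fun k => star (z k)) * genSpan z := by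
  rw [Submodule.one_le, ← h.sum_star_mul]
  exact Submodule.sum_mem _ fun i _ => Submodule.mul_mem_mul
    (mem_genSpan (fun k => star (z k)) i) (mem_genSpan z i)

theorem one_le_pow_mul_pow {P Q : Submodule ℂ A} (h : 1 ≤ P * Q) (m : ℕ) : 1 ≤ P ^ m * Q ^ m := by
  induction m with
  | zero => simp
  | succ m ih =>
    calc 1 ≤ P * 1 * Q := by simpa using h
      _ ≤ P * (P ^ m * Q ^ m) * Q := by gcongr
      _ = P ^ (m + 1) * Q ^ (m + 1) := by rw [pow_succ', pow_succ]; simp only [mul_assoc]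

/-- The closed unital `*`-subalgebra generated by the words of length `K`. -/
def wordAlg (K : ℕ) (z : Fin N → A) : StarSubalgebra ℂ A :=
  (StarAlgebra.adjoin ℂ (Set.range (word z : (Fin K → Fin N) → A))).topologicalClosure

/-- `wordAlg` as a subspace. -/
def wordSpace (K : ℕ) (z : Fin N → A) : Submodule ℂ A :=
  Subalgebra.toSubmodule (wordAlg K z).toSubalgebra

theorem isClosed_wordAlg : IsClosed (wordAlg K z : Set A) :=
  StarSubalgebra.isClosed_topologicalClosure _

theorem word_mem_wordAlg (i : Fin K → Fin N) : word z i ∈ wordAlg K z :=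
  StarSubalgebra.le_topologicalClosure _ (StarAlgebra.subset_adjoin ℂ _ ⟨i, rfl⟩)

theorem wordSpace_mul_self : wordSpace K z * wordSpace K z ≤ wordSpace K z :=
  Submodule.mul_le.2 fun _ ha _ hb => mul_mem (S := StarSubalgebra ℂ A) ha hb

theorem genSpan_pow_le : genSpan z ^ K ≤ wordSpace K z := by
  rw [genSpan_pow, Submodule.span_le]
  rintro _ ⟨i, rfl⟩
  exact word_mem_wordAlg i

theorem star_genSpan_pow_le : genSpan (fun k => star (z k)) ^ K ≤ wordSpace K z := by
  rw [genSpan_pow, Submodule.span_le]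
  rintro _ ⟨i, rfl⟩
  rw [word_star]
  exact star_mem (S := StarSubalgebra ℂ A) (word_mem_wordAlg _)

/-- With K = k + 1, inserting 1 ∈ S^k Z^k in the middle gives SZ ⊆ S^K Z^K, a product of two
subspaces of W. -/
theorem star_genSpan_mul_genSpan_le [NeZero K] (h : IsHalfLiberated K z) :
    genSpan (fun k => star (z k)) * genSpan z ≤ wordSpace K z := by
  obtain ⟨k, rfl⟩ := Nat.exists_eq_succ_of_ne_zero (NeZero.ne K)
  set Z := genSpan z
  set S := genSpan (fun k => star (z k))
  calc S * Z = S * 1 * Z := by simp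
    _ ≤ S * (S ^ k * Z ^ k) * Z := by gcongr; exact one_le_pow_mul_pow (one_le_star_genSpan_mul h) k
    _ = S ^ (k + 1) * Z ^ (k + 1) := by rw [pow_succ', pow_succ]; simp only [mul_assoc]
    _ ≤ wordSpace (k + 1) z * wordSpace (k + 1) z := by
      gcongr
      exacts [star_genSpan_pow_le, genSpan_pow_le]
    _ ≤ _ := wordSpace_mul_self

theorem genSpan_mul_star_genSpan_le [NeZero K] (h : IsHalfLiberated K z) :
    genSpan z * genSpan (fun k => star (z k)) ≤ wordSpace K z := by
  obtain ⟨k, rfl⟩ := Nat.exists_eq_succ_of_ne_zero (NeZero.ne K)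
  set Z := genSpan z
  set S := genSpan (fun k => star (z k))
  calc Z * S = Z * 1 * S := by simp
    _ ≤ Z * (Z ^ k * S ^ k) * S := by gcongr; exact one_le_pow_mul_pow (one_le_genSpan_mul h) k
    _ = Z ^ (k + 1) * S ^ (k + 1) := by rw [pow_succ', pow_succ]; simp only [mul_assoc]
    _ ≤ wordSpace (k + 1) z * wordSpace (k + 1) z := by
      gcongr
      exacts [genSpan_pow_le, star_genSpan_pow_le]
    _ ≤ _ := wordSpace_mul_self

/-- The condition is closed and linear in a, and compatible with products and adjoints, so it is
enough to check it on words of length K and on scalars. -/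
theorem star_mul_wordAlg_mul_mem [NeZero K] (h : IsHalfLiberated K z) {a : A}
    (ha : a ∈ wordAlg K z) : ∀ j k, star (z j) * a * z k ∈ wordAlg K z := by
  have hcl : IsClosed {a : A | ∀ j k, star (z j) * a * z k ∈ wordAlg K z} := by
    simp only [Set.ofPred_forall]
    exact isClosed_iInter fun j => isClosed_iInter fun k =>
      isClosed_wordAlg.preimage (f := fun a => star (z j) * a * z k) (by fun_prop)
  have h0 : ∀ j k, star (z j) * z k ∈ wordAlg K z := fun j k =>
    star_genSpan_mul_genSpan_le h (Submodule.mul_mem_mul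
      (mem_genSpan (fun k => star (z k)) j) (mem_genSpan z k))
  refine closure_minimal (fun b hb => ?_) hcl ha
  induction hb using StarAlgebra.adjoin_induction with
  | mem b hb =>
    obtain ⟨i, rfl⟩ := hb
    intro j k
    obtain ⟨m, rfl⟩ := Nat.exists_eq_succ_of_ne_zero (NeZero.ne K)
    -- The first letter of the word joins z_j^* to give an element of SZ ⊆ W; the other m letters
    -- followed by z_k form a word of length K = m + 1.
    rw [word_succ, ← mul_assoc, mul_assoc]
    refine mul_mem (h0 j (i 0)) ?_
    refine genSpan_pow_le (K := m + 1) ?_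
    rw [pow_succ]
    refine Submodule.mul_mem_mul ?_ (mem_genSpan z k)
    rw [genSpan_pow]
    exact Submodule.subset_span ⟨_, rfl⟩
  | algebraMap r =>
    intro j k
    rw [Algebra.algebraMap_eq_smul_one, mul_smul_comm, mul_one, smul_mul_assoc]
    exact (wordAlg K z).smul_mem (h0 j k) r
  | add b c _ _ hb hc =>
    intro j k
    rw [mul_add, add_mul]
    exact add_mem (hb j k) (hc j k)
  | mul b c _ _ hb hc =>
    intro j k
    -- Multiplicativity comes from inserting ∑ z_l z_l^* = 1 between the two factors.
    have : star (z j) * (b * c) * z k =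
        ∑ l, (star (z j) * b * z l) * (star (z l) * c * z k) := by
      calc _ = star (z j) * b * (∑ l, z l * star (z l)) * (c * z k) := by
            rw [h.sum_mul_star]; simp only [mul_assoc, one_mul]
        _ = _ := by
            rw [Finset.mul_sum, Finset.sum_mul]; simp only [mul_assoc]
    rw [this]
    exact sum_mem fun l _ => mul_mem (hb j l) (hc l k)
  | star b _ hb =>
    intro j k
    have := star_mem (hb k j)
    rwa [star_mul, star_mul, star_star, ← mul_assoc] at this

theorem star_genSpan_mul_wordSpace_mul_le [NeZero K] (h : IsHalfLiberated K z) :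
    genSpan (fun k => star (z k)) * wordSpace K z * genSpan z ≤ wordSpace K z := by
  rw [mul_assoc, genSpan, Submodule.mul_le]
  intro s hs
  suffices hsub : wordSpace K z * genSpan z ≤ (wordSpace K z).comap (LinearMap.mulLeft ℂ s) from
    fun n hn => hsub hn
  rw [genSpan, Submodule.mul_le]
  intro a ha t ht
  change s * (a * t) ∈ wordSpace K z
  induction hs using Submodule.span_induction with
  | zero => simp
  | add x y _ _ hx hy => rw [add_mul]; exact add_mem hx hy
  | smul c x _ hx => rw [smul_mul_assoc]; exact Submodule.smul_mem _ _ hx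
  | mem x hx =>
    obtain ⟨j, rfl⟩ := hx
    induction ht using Submodule.span_induction with
    | zero => simp
    | add x y _ _ hx hy => rw [mul_add, mul_add]; exact add_mem hx hy
    | smul c x _ hx => rw [mul_smul_comm, mul_smul_comm]; exact Submodule.smul_mem _ _ hx
    | mem x hx =>
      obtain ⟨k, rfl⟩ := hx
      rw [← mul_assoc]
      exact star_mul_wordAlg_mul_mem h ha j k

/-- WZ ⊆ (ZS)WZ = Z(SWZ) ⊆ ZW: elements of W can be moved to the right of generators. -/
theorem wordSpace_mul_genSpan_le [NeZero K] (h : IsHalfLiberated K z) :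
    wordSpace K z * genSpan z ≤ genSpan z * wordSpace K z := by
  set Z := genSpan z
  set S := genSpan (fun k => star (z k))
  calc wordSpace K z * Z = 1 * (wordSpace K z * Z) := by simp
    _ ≤ Z * S * (wordSpace K z * Z) := by gcongr; exact one_le_genSpan_mul h
    _ = Z * (S * wordSpace K z * Z) := by simp only [mul_assoc]
    _ ≤ _ := by gcongr; exact star_genSpan_mul_wordSpace_mul_le h

theorem wordSpace_mul_genSpan_pow_le [NeZero K] (h : IsHalfLiberated K z) (m : ℕ) :
    wordSpace K z * genSpan z ^ m ≤ genSpan z ^ m * wordSpace K z := by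
  induction m with
  | zero => simp
  | succ m ih =>
    calc _ = wordSpace K z * genSpan z ^ m * genSpan z := by rw [pow_succ, mul_assoc]
      _ ≤ genSpan z ^ m * wordSpace K z * genSpan z := by gcongr
      _ = genSpan z ^ m * (wordSpace K z * genSpan z) := by rw [mul_assoc]
      _ ≤ genSpan z ^ m * (genSpan z * wordSpace K z) := by
        gcongr genSpan z ^ m * ?_; exact wordSpace_mul_genSpan_le h
      _ = _ := by rw [pow_succ, mul_assoc]

/-- The span of the elements `w a`, where `w` is a word of length less than `K` and `a` belongs to
`wordAlg`. -/
def gradedSpan (K : ℕ) (z : Fin N → A) : Submodule ℂ A :=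
  ⨆ l : Fin K, genSpan z ^ (l : ℕ) * wordSpace K z

theorem le_gradedSpan {l : ℕ} (hl : l < K) :
    genSpan z ^ l * wordSpace K z ≤ gradedSpan K z :=
  le_iSup (fun l : Fin K => genSpan z ^ (l : ℕ) * wordSpace K z) ⟨l, hl⟩

/-- Multiplying by Z raises the degree l by one; when l + 1 = K it wraps around to degree 0, since
Z^K ⊆ W. -/
theorem genSpan_mul_gradedSpan_le [NeZero K] : genSpan z * gradedSpan K z ≤ gradedSpan K z := by
  rw [gradedSpan, Submodule.mul_iSup, iSup_le_iff]
  intro l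
  rw [← mul_assoc, ← pow_succ']
  rcases Nat.lt_or_ge ((l : ℕ) + 1) K with hl | hl
  · exact le_gradedSpan hl
  · have : (l : ℕ) + 1 = K := le_antisymm l.2 hl
    rw [this]
    calc genSpan z ^ K * wordSpace K z ≤ wordSpace K z * wordSpace K z := by
          gcongr; exact genSpan_pow_le
      _ ≤ genSpan z ^ 0 * wordSpace K z := by simpa using wordSpace_mul_self
      _ ≤ _ := le_gradedSpan (NeZero.pos K)

theorem star_genSpan_mul_gradedSpan_le [NeZero K] (h : IsHalfLiberated K z) :
    genSpan (fun k => star (z k)) * gradedSpan K z ≤ gradedSpan K z := by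
  set S := genSpan (fun k => star (z k)) with hS
  rw [gradedSpan, Submodule.mul_iSup, iSup_le_iff]
  rintro ⟨l, hl⟩
  rcases l with _ | l
  -- In degree 0 the adjoint wraps around to degree K - 1 = m: SW ⊆ Z^m S^m SW = Z^m S^K W. In
  -- positive degree it cancels one factor Z, since SZ ⊆ W.
  · obtain ⟨m, rfl⟩ := Nat.exists_eq_succ_of_ne_zero (NeZero.ne K)
    calc S * (genSpan z ^ 0 * wordSpace (m + 1) z) = 1 * (S * wordSpace (m + 1) z) := by simp
      _ ≤ (genSpan z ^ m * S ^ m) * (S * wordSpace (m + 1) z) := by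
        gcongr; exact one_le_pow_mul_pow (one_le_genSpan_mul h) m
      _ = genSpan z ^ m * (S ^ (m + 1) * wordSpace (m + 1) z) := by
        rw [pow_succ]; simp only [mul_assoc]
      _ ≤ genSpan z ^ m * (wordSpace (m + 1) z * wordSpace (m + 1) z) := by
        gcongr; exact star_genSpan_pow_le
      _ ≤ genSpan z ^ m * wordSpace (m + 1) z := by gcongr; exact wordSpace_mul_self
      _ ≤ _ := le_gradedSpan (Nat.lt_succ_self m)
  · calc S * (genSpan z ^ (l + 1) * wordSpace K z)
        = S * genSpan z * (genSpan z ^ l * wordSpace K z) := by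
          rw [pow_succ']; simp only [mul_assoc]
      _ ≤ wordSpace K z * (genSpan z ^ l * wordSpace K z) := by
        gcongr; exact star_genSpan_mul_genSpan_le h
      _ = wordSpace K z * genSpan z ^ l * wordSpace K z := by rw [mul_assoc]
      _ ≤ genSpan z ^ l * wordSpace K z * wordSpace K z := by
        gcongr ?_ * wordSpace K z; exact wordSpace_mul_genSpan_pow_le h l
      _ = genSpan z ^ l * (wordSpace K z * wordSpace K z) := by rw [mul_assoc]
      _ ≤ genSpan z ^ l * wordSpace K z := by gcongr; exact wordSpace_mul_self
      _ ≤ _ := le_gradedSpan (Nat.lt_of_succ_lt hl)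

theorem adjoin_le_gradedSpan [NeZero K] (h : IsHalfLiberated K z) {a : A}
    (ha : a ∈ StarAlgebra.adjoin ℂ (Set.range z)) : a ∈ gradedSpan K z := by
  -- Stability under left multiplication is proved by induction on a, then applied to 1.
  have key : ∀ b ∈ gradedSpan K z, a * b ∈ gradedSpan K z := by
    change a ∈ Algebra.adjoin ℂ (Set.range z ∪ star (Set.range z)) at ha
    induction ha using Algebra.adjoin_induction with
    | algebraMap r =>
      intro b hb
      rw [← Algebra.smul_def]
      exact Submodule.smul_mem _ _ hb
    | add x y _ _ hx hy => intro b hb; rw [add_mul]; exact add_mem (hx b hb) (hy b hb)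
    | mul x y _ _ hx hy => intro b hb; rw [mul_assoc]; exact hx _ (hy b hb)
    | mem x hx =>
      intro b hb
      rcases hx with ⟨i, rfl⟩ | hx
      · exact genSpan_mul_gradedSpan_le (Submodule.mul_mem_mul (mem_genSpan z i) hb)
      · obtain ⟨i, hi⟩ := hx
        obtain rfl : star (z i) = x := by rw [hi, star_star]
        exact star_genSpan_mul_gradedSpan_le h
          (Submodule.mul_mem_mul (mem_genSpan (fun k => star (z k)) i) hb)
  have h1 : (1 : A) ∈ gradedSpan K z :=
    le_gradedSpan (NeZero.pos K) (by rw [pow_zero, one_mul]; exact one_mem (wordAlg K z))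
  simpa using key 1 h1

/-! ### Commutation and exchange relations -/

theorem wordAlg_commute (h : IsHalfLiberated K z) {a b : A} (ha : a ∈ wordAlg K z)
    (hb : b ∈ wordAlg K z) : a * b = b * a := by
  have hs : ∀ x ∈ Set.range (word z : (Fin K → Fin N) → A),
      ∀ y ∈ Set.range (word z : (Fin K → Fin N) → A), x * star y = star y * x := by
    rintro _ ⟨i, rfl⟩ _ ⟨j, rfl⟩
    have := h.comm_star i (fun c => j c.rev)
    rw [word_star] at this
    simpa using this
  have hc := StarAlgebra.isMulCommutative_adjoin ℂ
    (s := Set.range (word z : (Fin K → Fin N) → A)) (by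
      rintro _ ⟨i, rfl⟩ _ ⟨j, rfl⟩; exact h.comm i j) hs
  let _ := StarSubalgebra.commRingTopologicalClosure
    (StarAlgebra.adjoin ℂ (Set.range (word z : (Fin K → Fin N) → A))) hc.is_comm.comm
  exact congrArg Subtype.val (mul_comm
    (⟨a, ha⟩ : (StarAlgebra.adjoin ℂ
      (Set.range (word z : (Fin K → Fin N) → A))).topologicalClosure) ⟨b, hb⟩)

/-- Insert ∑ z_k z_k^* = 1 in front of z_j x z_i. Commuting z_k^* z_j with x z_i, then z_k x with
z_i z_k^*, all in the commutative W, leaves z_i (∑ z_k^* z_k) x z_j. -/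
theorem exchange {m : ℕ} (h : IsHalfLiberated (m + 1) z) {x : A} (hx : x ∈ genSpan z ^ m)
    (i j : Fin N) : z i * x * z j = z j * x * z i := by
  have h1 : ∀ k, star (z k) * z j ∈ wordAlg (m + 1) z := fun k =>
    star_genSpan_mul_genSpan_le h (Submodule.mul_mem_mul
      (mem_genSpan (fun k => star (z k)) k) (mem_genSpan z j))
  have h2 : ∀ k, z i * star (z k) ∈ wordAlg (m + 1) z := fun k =>
    genSpan_mul_star_genSpan_le h (Submodule.mul_mem_mul
      (mem_genSpan z i) (mem_genSpan (fun k => star (z k)) k))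
  have h3 : x * z i ∈ wordAlg (m + 1) z := genSpan_pow_le (K := m + 1) (by
    rw [pow_succ]; exact Submodule.mul_mem_mul hx (mem_genSpan z i))
  have h4 : ∀ k, z k * x ∈ wordAlg (m + 1) z := fun k => genSpan_pow_le (K := m + 1) (by
    rw [pow_succ']; exact Submodule.mul_mem_mul (mem_genSpan z k) hx)
  symm
  calc z j * x * z i = (∑ k, z k * star (z k)) * (z j * x * z i) := by
        rw [h.sum_mul_star, one_mul]
    _ = ∑ k, z k * ((star (z k) * z j) * (x * z i)) := by
        rw [Finset.sum_mul]; simp only [mul_assoc]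
    _ = ∑ k, (z k * x) * (z i * star (z k)) * z j := by
        refine Finset.sum_congr rfl fun k _ => ?_
        rw [wordAlg_commute h (h1 k) h3]; simp only [mul_assoc]
    _ = ∑ k, z i * ((star (z k) * z k) * (x * z j)) := by
        refine Finset.sum_congr rfl fun k _ => ?_
        rw [wordAlg_commute h (h4 k) (h2 k)]; simp only [mul_assoc]
    _ = z i * ((∑ k, star (z k) * z k) * (x * z j)) := by
        rw [Finset.sum_mul, Finset.mul_sum]
    _ = _ := by rw [h.sum_star_mul, one_mul, mul_assoc]

theorem prod_map_mem_genSpan_pow (z : Fin N → A) (L : List (Fin N)) :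
    (L.map z).prod ∈ genSpan z ^ L.length := by
  induction L with
  | nil => exact Submodule.one_le.1 le_rfl
  | cons i L ih =>
    rw [List.map_cons, List.prod_cons, List.length_cons, pow_succ']
    exact Submodule.mul_mem_mul (mem_genSpan z i) ih

theorem word_eq_map {A : Type*} [Monoid A] {N m : ℕ} (a : Fin N → A) (i : Fin m → Fin N) :
    word a i = ((List.ofFn i).map a).prod := by
  rw [word, List.map_ofFn]; rfl

theorem ofFn_update {α : Type*} {m : ℕ} (f : Fin m → α) (c : Fin m) (x : α) :
    List.ofFn (Function.update f c x) =
      (List.ofFn f).take c ++ x :: (List.ofFn f).drop (c + 1) := by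
  have : List.ofFn (Function.update f c x) = (List.ofFn f).set c x := by
    refine List.ext_getElem (by simp) fun n h1 h2 => ?_
    simp only [List.getElem_ofFn, List.getElem_set, Function.update_apply, Fin.ext_iff, eq_comm]
  rw [this, List.set_eq_take_append_cons_drop, if_pos (by simp)]

/-- Between the letters at position c of the two consecutive words there are exactly K - 1 letters,
so `exchange` swaps them. This is the pure tensor relation at the level of words. -/
theorem word_update_mul_word_update [NeZero K] (h : IsHalfLiberated K z) (i j : Fin K → Fin N)
    (c : Fin K) (k l : Fin N) :
    word z (Function.update i c k) * word z (Function.update j c l) =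
      word z (Function.update i c l) * word z (Function.update j c k) := by
  obtain ⟨m, rfl⟩ := Nat.exists_eq_succ_of_ne_zero (NeZero.ne K)
  simp only [word_eq_map, ofFn_update, List.map_append, List.map_cons, List.prod_append,
    List.prod_cons]
  -- The letters in between are the m - c last ones of the first word and the c first ones of the
  -- second.
  have hx : (((List.ofFn i).drop (c + 1)).map z).prod * (((List.ofFn j).take c).map z).prod ∈
      genSpan z ^ m := by
    have hlen : ((List.ofFn i).drop (c + 1)).length + ((List.ofFn j).take c).length = m := by
      have := c.2
      simp only [List.length_drop, List.length_ofFn, List.length_take]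
      omega
    have := Submodule.mul_mem_mul (prod_map_mem_genSpan_pow z ((List.ofFn i).drop (c + 1)))
      (prod_map_mem_genSpan_pow z ((List.ofFn j).take c))
    rwa [← pow_add, hlen] at this
  have key := exchange h hx k l
  generalize (((List.ofFn i).drop (c + 1)).map z).prod = x at *
  generalize (((List.ofFn j).take c).map z).prod = y at *
  generalize (((List.ofFn i).take c).map z).prod = u at *
  generalize (((List.ofFn j).drop (c + 1)).map z).prod = v at *
  calc _ = u * (z k * (x * y) * z l) * v := by simp only [mul_assoc]
    _ = u * (z l * (x * y) * z k) * v := by rw [key]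
    _ = _ := by simp only [mul_assoc]

end words

end HalfLib

namespace HalfLib

theorem continuous_starAlgHom {A C : Type*} [CStarAlgebra A] [CStarAlgebra C]
    (f : A →⋆ₐ[ℂ] C) : Continuous f := by
  open scoped CStarAlgebra in exact map_continuous f

/-! ### The universal property of the half-liberated sphere -/

section universal

variable {N K : ℕ}

theorem univPoint_isHalfLiberated (N K : ℕ) : IsHalfLiberated K (univPoint N K) := by
  have hw : ∀ {m : ℕ} (a : Fin N → Families N K) (i : Fin m → Fin N) (r : Realization N K),
      (word a i : Families N K) r = word (fun k => a k r) i := by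
    intro m a i r
    induction m with
    | zero => rfl
    | succ m ih => rw [word_succ, word_succ, ← ih]; rfl
  have hs : ∀ (f : Fin N → Families N K) (r : Realization N K),
      (∑ k, f k : Families N K) r = ∑ k, f k r := by
    intro f r
    rw [lp.coeFn_sum, Finset.sum_apply]
  refine ⟨?_, ?_, fun i j => ?_, fun i j => ?_⟩ <;> refine lp.ext (funext fun r => ?_)
  · rw [hs]; exact r.rel.sum_mul_star
  · rw [hs]; exact r.rel.sum_star_mul
  · change (word (univPoint N K) i) r * (word (univPoint N K) j) r =
      (word (univPoint N K) j) r * (word (univPoint N K) i) r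
    rw [hw, hw]; exact r.rel.comm i j
  · change (word (univPoint N K) i) r * (word (fun k => star (univPoint N K k)) j) r =
      (word (fun k => star (univPoint N K k)) j) r * (word (univPoint N K) i) r
    rw [hw, hw]; exact r.rel.comm_star i j

/-- The inclusion of `C(S^{N-1}_{ℂ,K})` into the algebra of bounded families. -/
def toFamilies (N K : ℕ) : CSphere N K →⋆ₐ[ℂ] Families N K := (sphereSubalgebra N K).subtype

theorem toFamilies_injective : Function.Injective (toFamilies N K) := Subtype.val_injective

theorem toFamilies_star (a : CSphere N K) :
    toFamilies N K (star a) = star (toFamilies N K a) := map_star (toFamilies N K) a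

theorem toFamilies_zgen (i : Fin N) : toFamilies N K (zgen N K i) = univPoint N K i := rfl

theorem map_word {A B F : Type*} [Monoid A] [Monoid B] [FunLike F A B] [MonoidHomClass F A B]
    (f : F) {m : ℕ} (a : Fin N → A) (i : Fin m → Fin N) :
    f (word a i) = word (fun k => f (a k)) i := by
  rw [word, map_list_prod, List.map_ofFn]; rfl

theorem zgen_isHalfLiberated (N K : ℕ) : IsHalfLiberated K (zgen N K) := by
  have h := univPoint_isHalfLiberated N K
  refine ⟨?_, ?_, fun i j => ?_, fun i j => ?_⟩ <;> apply toFamilies_injective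
  · simpa [toFamilies_zgen, toFamilies_star] using h.sum_mul_star
  · simpa [toFamilies_zgen, toFamilies_star] using h.sum_star_mul
  · simpa only [map_mul, map_word, toFamilies_zgen, toFamilies_star] using h.comm i j
  · simpa only [map_mul, map_word, toFamilies_zgen, toFamilies_star] using h.comm_star i j

theorem dense_adjoin_zgen (N K : ℕ) (a : CSphere N K) :
    a ∈ closure (StarAlgebra.adjoin ℂ (Set.range (zgen N K)) : Set (CSphere N K)) := by
  have hmap : (StarAlgebra.adjoin ℂ (Set.range (zgen N K))).map (toFamilies N K) =
      StarAlgebra.adjoin ℂ (Set.range (univPoint N K)) := by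
    rw [StarAlgHom.map_adjoin, ← Set.range_comp]; rfl
  have ha : (toFamilies N K a) ∈
      closure ((StarAlgebra.adjoin ℂ (Set.range (univPoint N K)) : Set (Families N K))) := a.2
  rw [← hmap] at ha
  have hi : Topology.IsInducing (toFamilies N K) := Topology.IsInducing.subtypeVal
  rw [hi.closure_eq_preimage_closure_image]
  exact ha

theorem hom_ext {C : Type*} [CStarAlgebra C] {f g : CSphere N K →⋆ₐ[ℂ] C}
    (h : ∀ i, f (zgen N K i) = g (zgen N K i)) : f = g := by
  ext a
  have hsub : (StarAlgebra.adjoin ℂ (Set.range (zgen N K)) : Set (CSphere N K)) ⊆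
      {a | f a = g a} := by
    have : StarAlgebra.adjoin ℂ (Set.range (zgen N K)) ≤ StarAlgHom.equalizer f g :=
      StarAlgebra.adjoin_le (by rintro _ ⟨i, rfl⟩; exact h i)
    exact this
  exact closure_minimal hsub (isClosed_eq (continuous_starAlgHom f)
    (continuous_starAlgHom g))
    (dense_adjoin_zgen N K a)

/-- Evaluation of a bounded family at a realization. -/
def evalFamily (r : Realization N K) : Families N K →⋆ₐ[ℂ] r.carrier where
  toFun f := f r
  map_one' := rfl
  map_mul' _ _ := rfl
  map_zero' := rfl
  map_add' _ _ := rfl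
  commutes' _ := rfl
  map_star' _ := rfl

theorem exists_lift {C : Type} [CStarAlgebra C] {a : Fin N → C} (h : IsHalfLiberated K a) :
    ∃ f : CSphere N K →⋆ₐ[ℂ] C, ∀ i, f (zgen N K i) = a i := by
  -- Realizations are nonzero by definition, so the zero algebra needs its own morphism; it occurs
  -- as C(T) ⋊ ℤ_K for empty T.
  rcases subsingleton_or_nontrivial C with _ | _
  · exact ⟨{ toFun := fun _ => 0
             map_one' := Subsingleton.elim _ _
             map_mul' := fun _ _ => Subsingleton.elim _ _
             map_zero' := Subsingleton.elim _ _
             map_add' := fun _ _ => Subsingleton.elim _ _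
             commutes' := fun _ => Subsingleton.elim _ _
             map_star' := fun _ => Subsingleton.elim _ _ }, fun _ => Subsingleton.elim _ _⟩
  · exact ⟨(evalFamily (⟨C, a, h⟩ : Realization N K)).comp (toFamilies N K), fun i => rfl⟩

theorem root_pow (ω : rootsOfUnity K ℂ) : ((ω : ℂˣ) : ℂ) ^ K = 1 :=
  (mem_rootsOfUnity' K (ω : ℂˣ)).1 ω.2

theorem root_ne_zero (ω : rootsOfUnity K ℂ) : ((ω : ℂˣ) : ℂ) ≠ 0 := Units.ne_zero _

/-- Inserts 1 ∈ Z^l S^l. For a of degree l the part S^l a has degree zero, which reduces questions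
about A_l to A_0. -/
theorem mem_genSpan_pow_mul (l : ℕ) (a : CSphere N K) :
    a ∈ genSpan (zgen N K) ^ l * (genSpan (fun k => star (zgen N K k)) ^ l * Submodule.span ℂ {a}) := by
  rw [← mul_assoc]
  have h := Submodule.mul_mem_mul (Submodule.one_le.1
    (one_le_pow_mul_pow (one_le_genSpan_mul (zgen_isHalfLiberated N K)) l))
    (Submodule.mem_span_singleton_self (R := ℂ) a)
  rwa [one_mul] at h

end universal

/-! ### The grading -/

section grading

variable {N K : ℕ} [NeZero K]

theorem rotation_rotation (ω η : rootsOfUnity K ℂ) (a : CSphere N K) :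
    rotation ω (rotation η a) = rotation (ω * η) a := by
  have : (rotation ω).comp (rotation η) = rotation (N := N) (ω * η) := by
    refine hom_ext fun i => ?_
    rw [StarAlgHom.comp_apply, rotation_zgen, map_smul, rotation_zgen, rotation_zgen, smul_smul,
      mul_comm]
    rfl
  exact congrArg (fun f => f a) this

theorem star_root (ω : rootsOfUnity K ℂ) : star ((ω : ℂˣ) : ℂ) = ((ω : ℂˣ) : ℂ) ^ (K - 1) := by
  have hn : ‖((ω : ℂˣ) : ℂ)‖ = 1 := Complex.norm_eq_one_of_pow_eq_one (root_pow ω) (NeZero.ne K)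
  have hc : ((ω : ℂˣ) : ℂ) * star ((ω : ℂˣ) : ℂ) = 1 := by
    have := Complex.mul_conj' ((ω : ℂˣ) : ℂ)
    rw [hn] at this
    simpa using this
  refine mul_left_cancel₀ (root_ne_zero ω) ?_
  rw [hc, mul_pow_sub_one (NeZero.ne K), root_pow]

theorem mem_gradedPart {l : ℕ} {a : CSphere N K} :
    a ∈ gradedPart N K l ↔ ∀ ω : rootsOfUnity K ℂ, rotation ω a = ((ω : ℂˣ) : ℂ) ^ l • a := Iff.rfl

theorem mem_gradedPart_zero {a : CSphere N K} :
    a ∈ gradedPart N K 0 ↔ ∀ ω : rootsOfUnity K ℂ, rotation ω a = a := by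
  simp [mem_gradedPart]

theorem isClosed_gradedPart (l : ℕ) : IsClosed (gradedPart N K l : Set (CSphere N K)) := by
  change IsClosed {a : CSphere N K |
    ∀ ω : rootsOfUnity K ℂ, rotation ω a = ((ω : ℂˣ) : ℂ) ^ l • a}
  simp only [Set.ofPred_forall]
  exact isClosed_iInter fun ω => isClosed_eq (continuous_starAlgHom (rotation ω)) (by fun_prop)

theorem gradedPart_mul_le (l m : ℕ) :
    gradedPart N K l * gradedPart N K m ≤ gradedPart N K (l + m) := by
  refine Submodule.mul_le.2 fun a ha b hb ω => ?_
  rw [map_mul, ha ω, hb ω, smul_mul_smul_comm, pow_add]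

theorem gradedPart_mul_K (l : ℕ) : gradedPart N K (l * K) = gradedPart N K 0 := by
  ext a
  simp only [mem_gradedPart, mul_comm l K, pow_mul, root_pow, one_pow, pow_zero]

theorem one_mem_gradedPart : (1 : CSphere N K) ∈ gradedPart N K 0 :=
  mem_gradedPart_zero.2 fun _ => map_one _

theorem pow_le_gradedPart {P : Submodule ℂ (CSphere N K)} {d : ℕ} (h : P ≤ gradedPart N K d)
    (m : ℕ) : P ^ m ≤ gradedPart N K (m * d) := by
  induction m with
  | zero =>
    rw [pow_zero, Submodule.one_le, zero_mul]
    exact one_mem_gradedPart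
  | succ m ih =>
    rw [pow_succ, add_mul, one_mul]
    exact (mul_le_mul' ih h).trans (gradedPart_mul_le _ _)

theorem genSpan_le_gradedPart : genSpan (zgen N K) ≤ gradedPart N K 1 := by
  refine Submodule.span_le.2 ?_
  rintro _ ⟨i, rfl⟩ ω
  rw [rotation_zgen, pow_one]

/-- On K-th roots of unity, conjugation is the power K - 1; degrees thus stay natural numbers. -/
theorem star_genSpan_le_gradedPart :
    genSpan (fun k => star (zgen N K k)) ≤ gradedPart N K (K - 1) := by
  refine Submodule.span_le.2 ?_
  rintro _ ⟨i, rfl⟩ ω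
  simp only [map_star, rotation_zgen, star_smul, star_root]

theorem genSpan_pow_le_gradedPart (l : ℕ) : genSpan (zgen N K) ^ l ≤ gradedPart N K l := by
  simpa using pow_le_gradedPart genSpan_le_gradedPart l

theorem star_genSpan_pow_mul_le (l : ℕ) :
    genSpan (fun k => star (zgen N K k)) ^ l * gradedPart N K l ≤ gradedPart N K 0 := by
  calc _ ≤ gradedPart N K (l * (K - 1)) * gradedPart N K l := by
        gcongr; exact pow_le_gradedPart star_genSpan_le_gradedPart l
    _ ≤ gradedPart N K (l * (K - 1) + l) := gradedPart_mul_le _ _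
    _ = gradedPart N K (l * K) := by
        congr 1
        rw [← Nat.mul_succ, Nat.succ_eq_add_one, Nat.sub_add_cancel (NeZero.pos K)]
    _ ≤ _ := (gradedPart_mul_K l).le

instance rootsOfUnityFintype : Fintype (rootsOfUnity K ℂ) := Fintype.ofFinite _

theorem card_roots : Fintype.card (rootsOfUnity K ℂ) = K := by
  rw [← Nat.card_eq_fintype_card, Complex.card_rootsOfUnity]

/-- The projection onto the component of degree `l`. -/
def proj (l : ℕ) (a : CSphere N K) : CSphere N K :=
  (K : ℂ)⁻¹ • ∑ ω : rootsOfUnity K ℂ, (((ω : ℂˣ) : ℂ)⁻¹) ^ l • rotation ω a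

theorem proj_add (l : ℕ) (a b : CSphere N K) : proj l (a + b) = proj l a + proj l b := by
  simp only [proj, map_add, smul_add, Finset.sum_add_distrib]

theorem continuous_proj (l : ℕ) : Continuous (proj (N := N) (K := K) l) := by
  have h : ∀ ω : rootsOfUnity K ℂ, Continuous fun a : CSphere N K =>
      (((ω : ℂˣ) : ℂ)⁻¹) ^ l • rotation ω a := fun ω =>
    (continuous_const_smul _).comp (continuous_starAlgHom (rotation ω))
  exact (continuous_const_smul ((K : ℂ)⁻¹)).comp
    (continuous_finsetSum Finset.univ fun ω _ => h ω)

theorem rotation_proj (l : ℕ) (η : rootsOfUnity K ℂ) (a : CSphere N K) :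
    rotation η (proj l a) = ((η : ℂˣ) : ℂ) ^ l • proj l a := by
  rw [proj, map_smul, map_sum, smul_comm,
    Finset.smul_sum (r := ((η : ℂˣ) : ℂ) ^ l)]
  congr 1
  refine Fintype.sum_equiv (Equiv.mulLeft η) _ _ fun ω => ?_
  rw [map_smul, rotation_rotation, Equiv.coe_mulLeft, smul_smul, ← mul_pow]
  congr 2
  have := root_ne_zero η
  have := root_ne_zero ω
  simp only [Subgroup.coe_mul, Units.val_mul]
  field_simp

theorem proj_mem_gradedPart (l : ℕ) (a : CSphere N K) : proj l a ∈ gradedPart N K l :=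
  fun η => rotation_proj l η a

theorem proj_of_mem {l : ℕ} {a : CSphere N K} (ha : a ∈ gradedPart N K l) : proj l a = a := by
  have : ∀ ω : rootsOfUnity K ℂ, (((ω : ℂˣ) : ℂ)⁻¹) ^ l • rotation ω a = a := fun ω => by
    rw [ha ω, smul_smul, ← mul_pow, inv_mul_cancel₀ (root_ne_zero ω), one_pow, one_smul]
  simp only [proj, this, Finset.sum_const, Finset.card_univ, card_roots]
  rw [← Nat.cast_smul_eq_nsmul ℂ, smul_smul, inv_mul_cancel₀ (Nat.cast_ne_zero.2 (NeZero.ne K)),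
    one_smul]

theorem exists_root_pow_ne_one {l : ℕ} (h0 : l ≠ 0) (hl : l < K) :
    ∃ ω : rootsOfUnity K ℂ, ((ω : ℂˣ) : ℂ) ^ l ≠ 1 := by
  have hp := Complex.isPrimitiveRoot_exp K (NeZero.ne K)
  refine ⟨hp.toRootsOfUnity, ?_⟩
  exact hp.pow_ne_one_of_pos_of_lt h0 hl

theorem proj_zero_of_mem {l : ℕ} (h0 : l ≠ 0) (hl : l < K) {a : CSphere N K}
    (ha : a ∈ gradedPart N K l) : proj 0 a = 0 := by
  obtain ⟨η, hη⟩ := exists_root_pow_ne_one h0 hl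
  -- The average over μ_K absorbs the rotation by η, while on A_l that rotation is the scalar η^l ≠
  -- 1; so the average vanishes.
  have h1 : proj 0 (rotation η a) = ((η : ℂˣ) : ℂ) ^ l • proj 0 a := by
    rw [ha η]
    simp only [proj, map_smul, Finset.smul_sum, smul_comm _ (((η : ℂˣ) : ℂ) ^ l)]
  have h2 : proj 0 (rotation η a) = proj 0 a := by
    simp only [proj, rotation_rotation, pow_zero, one_smul]
    congr 1
    exact Fintype.sum_equiv (Equiv.mulRight η) _ _ fun ω => rfl
  rw [h2] at h1
  have h3 : (((η : ℂˣ) : ℂ) ^ l - 1) • proj 0 a = 0 := by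
    rw [sub_smul, one_smul, ← h1, sub_self]
  exact (smul_eq_zero.1 h3).resolve_left (sub_ne_zero.2 hη)

/-- After exchanging the sums, the coefficient of ω · a is a geometric sum of powers of ω^{-1},
which vanishes unless ω = 1. -/
theorem sum_proj (a : CSphere N K) : ∑ l ∈ Finset.range K, proj l a = a := by
  simp only [proj, ← Finset.smul_sum]
  rw [Finset.sum_comm]
  simp only [← Finset.sum_smul]
  have hK : (K : ℂ) ≠ 0 := Nat.cast_ne_zero.2 (NeZero.ne K)
  rw [Finset.sum_eq_single 1]
  · have h1 : rotation (1 : rootsOfUnity K ℂ) a = a := by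
      have : rotation (1 : rootsOfUnity K ℂ) = StarAlgHom.id ℂ (CSphere N K) :=
        hom_ext fun i => by simp [rotation_zgen]
      rw [this]; rfl
    simp [h1, smul_smul, hK]
  · intro ω _ hω
    have h1 : ((ω : ℂˣ) : ℂ)⁻¹ ≠ 1 := by
      intro h
      refine hω (Subtype.ext (Units.ext ?_))
      simpa using h
    rw [geom_sum_eq h1, inv_pow, root_pow]
    simp
  · simp

theorem wordAlg_le_gradedPart {a : CSphere N K} (ha : a ∈ wordAlg K (zgen N K)) :
    a ∈ gradedPart N K 0 := by
  refine closure_minimal (fun b hb => ?_) (isClosed_gradedPart 0) ha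
  rw [SetLike.mem_coe, mem_gradedPart_zero]
  intro ω
  have : StarAlgebra.adjoin ℂ (Set.range (word (zgen N K) : (Fin K → Fin N) → CSphere N K)) ≤
      StarAlgHom.equalizer (rotation ω) (StarAlgHom.id ℂ _) := by
    refine StarAlgebra.adjoin_le ?_
    rintro _ ⟨i, rfl⟩
    change rotation ω (word (zgen N K) i) = word (zgen N K) i
    simp only [map_word, rotation_zgen, word_smul, root_pow, one_smul]
  exact this hb

/-- The projection onto degree 0 fixes W and kills Z^l W for 0 < l < K, so it maps `gradedSpan` into
W. By density and continuity it maps all of A into the closed W. -/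
theorem mem_wordAlg_iff {a : CSphere N K} : a ∈ wordAlg K (zgen N K) ↔ a ∈ gradedPart N K 0 := by
  refine ⟨wordAlg_le_gradedPart, fun ha => ?_⟩
  have hM : ∀ b ∈ gradedSpan K (zgen N K), proj 0 b ∈ wordAlg K (zgen N K) := by
    intro b hb
    refine Submodule.iSup_induction _ (motive := fun b => proj 0 b ∈ wordAlg K (zgen N K)) hb
      ?_ ?_ ?_
    · rintro ⟨l, hl⟩ b hb
      rcases eq_or_ne l 0 with rfl | h0
      · have hb' : b ∈ wordAlg K (zgen N K) := by
          change b ∈ _ ^ 0 * _ at hb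
          rwa [pow_zero, one_mul] at hb
        rwa [proj_of_mem (wordAlg_le_gradedPart hb')]
      · have hb' : b ∈ gradedPart N K l := by
          have : genSpan (zgen N K) ^ l * wordSpace K (zgen N K) ≤
              gradedPart N K l * gradedPart N K 0 := by
            gcongr
            exacts [genSpan_pow_le_gradedPart l, fun x hx => wordAlg_le_gradedPart hx]
          exact gradedPart_mul_le l 0 (this hb)
        rw [proj_zero_of_mem h0 hl hb']
        exact zero_mem _
    · simp [proj]
    · intro x y hx hy
      rw [proj_add]
      exact add_mem hx hy
  rw [← proj_of_mem ha]
  refine closure_minimal (fun b hb => ?_) (isClosed_wordAlg.preimage (continuous_proj 0))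
    (dense_adjoin_zgen N K a)
  exact hM b (adjoin_le_gradedSpan (zgen_isHalfLiberated N K) hb)

end grading

end HalfLib

namespace HalfLib

/-! ### Pure tensors -/

section tensors

variable {N K : ℕ} [NeZero K]

theorem tensor_smul (c : ZMod K → ℂ) (v : ZMod K → EuclideanSpace ℂ (Fin N)) :
    tensor (fun k => c k • v k) = (∏ k, c k) • tensor v := by
  ext i
  simp [tensor, Finset.prod_mul_distrib]

theorem continuous_tensor :
    Continuous fun v : ZMod K → EuclideanSpace ℂ (Fin N) => tensor v := by
  refine (PiLp.continuous_toLp 2 _).comp (continuous_pi fun i => ?_)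
  exact continuous_finsetProd _ fun c _ =>
    (PiLp.continuous_apply 2 (fun _ : Fin N => ℂ) (i c)).comp (continuous_apply c)

theorem continuous_pureMap : Continuous (pureMap (N := N) (K := K)) :=
  (continuous_tensor.comp (continuous_pi fun c =>
    continuous_subtype_val.comp (continuous_apply c))).subtype_mk _

theorem pureMap_surjective : Function.Surjective (pureMap (N := N) (K := K)) := by
  rintro ⟨r, hr, v, hv, rfl⟩
  -- Normalizing the factors does not change the tensor, since the product of their norms is the
  -- norm of the tensor, namely 1.
  refine ⟨fun c => ⟨((‖v c‖ : ℂ)⁻¹) • v c, ?_⟩, Subtype.ext ?_⟩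
  · have := norm_ne_zero_iff.2 (hv c)
    simp [norm_smul, this]
  · change tensor (fun c => ((‖v c‖ : ℂ)⁻¹) • v c) = tensor v
    rw [tensor_smul, Finset.prod_inv_distrib, ← Complex.ofReal_prod, ← norm_tensor, hr]
    simp

instance : CompactSpace (pureTensors N K) := by
  refine ⟨?_⟩
  rw [← pureMap_surjective.range_eq]
  exact isCompact_range continuous_pureMap

theorem pureMap_apply (z : SphereProd N K) (i : ZMod K → Fin N) :
    rcoord i (pureMap z) = ∏ c, (z c : EuclideanSpace ℂ (Fin N)) (i c) := rfl

theorem cyc_pureMap (z : SphereProd N K) :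
    cyc (pureMap z : TensorPower N K) = pureMap (shift 1 z) := cyc_tensor _

theorem dense_adjoin_rcoord (N K : ℕ) [NeZero K] :
    (StarAlgebra.adjoin ℂ (Set.range
      (rcoord : (ZMod K → Fin N) → C(pureTensors N K, ℂ)))).topologicalClosure = ⊤ := by
  refine ContinuousMap.starSubalgebra_topologicalClosure_eq_top_of_separatesPoints _ ?_
  intro r s hrs
  have : ∃ i, r.1 i ≠ s.1 i := by
    by_contra! h
    exact hrs (Subtype.ext (PiLp.ext h))
  obtain ⟨i, hi⟩ := this
  exact ⟨_, ⟨rcoord i, StarAlgebra.subset_adjoin ℂ _ ⟨i, rfl⟩, rfl⟩, hi⟩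

theorem tensor_hom_ext {C : Type*} [CStarAlgebra C] {f g : C(pureTensors N K, ℂ) →⋆ₐ[ℂ] C}
    (h : ∀ i, f (rcoord i) = g (rcoord i)) : f = g := by
  ext a
  have hsub : StarAlgebra.adjoin ℂ (Set.range
      (rcoord : (ZMod K → Fin N) → C(pureTensors N K, ℂ))) ≤ StarAlgHom.equalizer f g :=
    StarAlgebra.adjoin_le (by rintro _ ⟨i, rfl⟩; exact h i)
  have ha : a ∈ (StarAlgebra.adjoin ℂ (Set.range
      (rcoord : (ZMod K → Fin N) → C(pureTensors N K, ℂ)))).topologicalClosure := by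
    rw [dense_adjoin_rcoord]; trivial
  exact closure_minimal (fun b hb => hsub hb)
    (isClosed_eq (continuous_starAlgHom f) (continuous_starAlgHom g)) ha

/-- A tensor whose coordinates can be exchanged factor by factor is a pure tensor. -/
theorem mem_pureTensors_of_exchange {r : TensorPower N K} (hr : ‖r‖ = 1)
    (hex : ∀ (i j : ZMod K → Fin N) (c : ZMod K),
      r i * r j = r (Function.update i c (j c)) * r (Function.update j c (i c))) :
    r ∈ pureTensors N K := by
  obtain ⟨j, hj⟩ : ∃ j, r j ≠ 0 := by
    by_contra! h
    have : r = 0 := PiLp.ext h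
    rw [this, norm_zero] at hr
    exact zero_ne_one hr
  -- Each exchange against one copy of r_j replaces an entry i_c by j_c and splits off the
  -- coordinate of j with i_c at place c. For s everything, r_i r_j^K = r_j ∏_c r(j with i_c at c).
  have key : ∀ (s : Finset (ZMod K)) (i : ZMod K → Fin N),
      r i * r j ^ s.card = r (fun c => if c ∈ s then j c else i c) *
        ∏ c ∈ s, r (Function.update j c (i c)) := by
    intro s
    induction s using Finset.induction_on with
    | empty => intro i; simp
    | insert a s ha ih =>
      intro i
      rw [Finset.card_insert_of_notMem ha, pow_succ, ← mul_assoc, ih,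
        Finset.prod_insert ha, mul_right_comm, hex _ j a, mul_assoc, if_neg ha]
      refine congrArg₂ (· * ·) (congrArg r.ofLp (funext fun c => ?_)) rfl
      by_cases hc : c = a
      · subst hc; simp
      · simp [Finset.mem_insert, hc]
  -- The factors are the slices of r through j; the constant r_j / r_j^K required by `key` is put
  -- into factor 0. Each slice is nonzero because its entry at j_c is a nonzero multiple of r_j.
  refine ⟨hr, fun c => WithLp.toLp 2 fun k =>
    (if c = 0 then r j / r j ^ K else 1) * r (Function.update j c k), fun c h => ?_, ?_⟩
  · have := congrArg (fun v : EuclideanSpace ℂ (Fin N) => v (j c)) h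
    simp only [Function.update_eq_self, PiLp.zero_apply] at this
    split_ifs at this <;> simp_all
  · ext i
    have h1 := key Finset.univ i
    simp only [Finset.mem_univ, if_true, Finset.card_univ, ZMod.card] at h1
    simp only [tensor, Finset.prod_mul_distrib, Finset.prod_ite_eq', Finset.mem_univ, if_true]
    rw [div_mul_eq_mul_div, eq_div_iff (pow_ne_zero _ hj)]
    exact h1

end tensors

end HalfLib

namespace HalfLib

/-! ### The degree zero part as an algebra of functions -/

section degreeZero

open WeakDual

variable {N K : ℕ}

/-- A closed commutative unital `*`-subalgebra of a `C⋆`-algebra is a `C⋆`-algebra. -/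
abbrev commCStarAlgebraOfClosed {A : Type*} [CStarAlgebra A] (S : StarSubalgebra ℂ A)
    (hcl : IsClosed (S : Set A)) (hc : ∀ a ∈ S, ∀ b ∈ S, a * b = b * a) : CommCStarAlgebra S :=
  { StarSubalgebra.cstarAlgebra S (h_closed := hcl) with
    mul_comm := fun a b => Subtype.ext (hc a a.2 b b.2) }

/-- The closed `*`-subalgebra of `C(S^{N-1}_{ℂ,K})` generated by the words of length `K`, as a
commutative `C⋆`-algebra. -/
def WordAlgebra (N K : ℕ) : Type 1 := wordAlg K (zgen N K)

instance (N K : ℕ) : CommCStarAlgebra (WordAlgebra N K) :=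
  commCStarAlgebraOfClosed _ isClosed_wordAlg fun _ ha _ hb =>
    wordAlg_commute (zgen_isHalfLiberated N K) ha hb

/-- The inclusion of `WordAlgebra N K` into `C(S^{N-1}_{ℂ,K})`. -/
def ofWordAlgebra (N K : ℕ) : WordAlgebra N K →⋆ₐ[ℂ] CSphere N K := (wordAlg K (zgen N K)).subtype

theorem ofWordAlgebra_injective : Function.Injective (ofWordAlgebra N K) := Subtype.val_injective

variable [NeZero K]

/-- The enumeration `0, 1, …, K - 1` of `ℤ_K`. -/
def enumZMod (K : ℕ) [NeZero K] : Fin K ≃ ZMod K :=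
  Equiv.ofBijective (fun c => ((c : ℕ) : ZMod K)) <| by
    rw [Fintype.bijective_iff_injective_and_card]
    refine ⟨fun a b hab => Fin.ext ?_, by simp [ZMod.card]⟩
    have := congrArg ZMod.val hab
    simpa only [ZMod.val_cast_of_lt a.2, ZMod.val_cast_of_lt b.2] using this

theorem enumZMod_apply (c : Fin K) : enumZMod K c = ((c : ℕ) : ZMod K) := rfl

/-- The word `z_{i_0} ⋯ z_{i_{K-1}}`. -/
def zword (i : ZMod K → Fin N) : WordAlgebra N K :=
  ⟨word (zgen N K) (i ∘ enumZMod K), word_mem_wordAlg _⟩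

theorem ofWordAlgebra_zword (i : ZMod K → Fin N) :
    ofWordAlgebra N K (zword i) = word (zgen N K) (i ∘ enumZMod K) := rfl

theorem sum_zword_mul_star : ∑ i : ZMod K → Fin N, zword i * star (zword i) = 1 := by
  apply ofWordAlgebra_injective
  rw [map_sum, map_one, ← sum_word_mul_star (zgen_isHalfLiberated N K) K]
  refine Fintype.sum_equiv (Equiv.arrowCongr (enumZMod K).symm (Equiv.refl _)) _ _ fun i => ?_
  rw [map_mul, map_star (ofWordAlgebra N K)]
  rfl

theorem zword_exchange (i j : ZMod K → Fin N) (c : ZMod K) :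
    zword i * zword j =
      zword (Function.update i c (j c)) * zword (Function.update j c (i c)) := by
  apply ofWordAlgebra_injective
  have h := word_update_mul_word_update (zgen_isHalfLiberated N K) (i ∘ enumZMod K)
    (j ∘ enumZMod K) ((enumZMod K).symm c) (i c) (j c)
  simp only [map_mul, ofWordAlgebra_zword]
  simpa only [← Function.update_comp_equiv, Function.update_eq_self] using h

theorem sum_character_mul_star {E ι : Type*} [CommCStarAlgebra E] [Fintype ι] {w : ι → E}
    (χ : characterSpace ℂ E) (h : ∑ i, w i * star (w i) = 1) :
    ∑ i, χ (w i) * star (χ (w i)) = 1 := by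
  rw [← map_one χ, ← h, map_sum]
  refine Finset.sum_congr rfl fun i _ => ?_
  rw [map_mul, map_star]

theorem character_mul_eq {E : Type*} [CommCStarAlgebra E] (χ : characterSpace ℂ E) {a b c d : E}
    (h : a * b = c * d) : χ a * χ b = χ c * χ d := by
  rw [← map_mul, ← map_mul, h]

/-- The pure tensor attached to a character of `WordAlgebra N K`. -/
def characterTensor (χ : characterSpace ℂ (WordAlgebra N K)) : pureTensors N K :=
  ⟨WithLp.toLp 2 fun i => χ (zword i), by
    refine mem_pureTensors_of_exchange ?_ fun i j c => ?_
    · have h1 : (∑ i : ZMod K → Fin N, χ (zword i) * star (χ (zword i))) = 1 := by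
        exact sum_character_mul_star χ sum_zword_mul_star
      have h2 : (‖(WithLp.toLp 2 fun i => χ (zword i) : TensorPower N K)‖ ^ 2 : ℝ) = 1 := by
        rw [EuclideanSpace.norm_sq_eq]
        have h3 : ((∑ i : ZMod K → Fin N, ‖χ (zword i)‖ ^ 2 : ℝ) : ℂ) = 1 := by
          rw [← h1, Complex.ofReal_sum]
          refine Finset.sum_congr rfl fun i _ => ?_
          rw [Complex.ofReal_pow, ← Complex.mul_conj']
          rfl
        exact_mod_cast h3
      exact (pow_eq_one_iff_of_nonneg (norm_nonneg _) two_ne_zero).1 h2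
    · exact character_mul_eq χ (zword_exchange i j c)⟩

theorem continuous_characterTensor : Continuous (characterTensor (N := N) (K := K)) := by
  refine Continuous.subtype_mk ((PiLp.continuous_toLp 2 _).comp (continuous_pi fun i => ?_)) _
  exact (gelfandTransform ℂ (WordAlgebra N K) (zword i)).continuous

/-- The morphism `C(P_u) → C(S^{N-1}_{ℂ,K})` with `r_{i_0 … i_{K-1}} ↦ z_{i_0} ⋯ z_{i_{K-1}}`. -/
def tensorHom (N K : ℕ) [NeZero K] : C(pureTensors N K, ℂ) →⋆ₐ[ℂ] CSphere N K :=
  (ofWordAlgebra N K).comp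
    (((gelfandStarTransform (WordAlgebra N K)).symm : _ →⋆ₐ[ℂ] WordAlgebra N K).comp
      (ContinuousMap.compStarAlgHom' ℂ ℂ
        (⟨characterTensor, continuous_characterTensor⟩ :
          C(characterSpace ℂ (WordAlgebra N K), pureTensors N K))))

/-- The coordinate function r_i composed with `characterTensor` is the Gelfand transform of the
word, by construction. -/
theorem tensorHom_rcoord (i : ZMod K → Fin N) :
    tensorHom N K (rcoord i) = word (zgen N K) fun c : Fin K => i ((c : ℕ) : ZMod K) := by
  have : (gelfandStarTransform (WordAlgebra N K)).symm
      ((rcoord i).comp ⟨characterTensor, continuous_characterTensor⟩) = zword i := by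
    rw [StarAlgEquiv.symm_apply_eq]
    ext χ
    rfl
  change ofWordAlgebra N K ((gelfandStarTransform (WordAlgebra N K)).symm
      ((rcoord i).comp ⟨characterTensor, continuous_characterTensor⟩)) = _
  rw [this]
  rfl

theorem tensorHom_mem (f : C(pureTensors N K, ℂ)) : tensorHom N K f ∈ gradedPart N K 0 :=
  mem_wordAlg_iff.1 (Subtype.property (p := fun a => a ∈ wordAlg K (zgen N K)) _)

/-- An injective *-homomorphism is isometric, so its range is closed; it contains the words of
length K, which generate A_0. -/
theorem range_tensorHom (h : Function.Injective (tensorHom N K)) :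
    Set.range (tensorHom N K) = (gradedPart N K 0 : Set (CSphere N K)) := by
  refine Set.Subset.antisymm (by rintro _ ⟨f, rfl⟩; exact tensorHom_mem f) fun a ha => ?_
  have hcl : IsClosed (Set.range (tensorHom N K)) :=
    (NonUnitalStarAlgHom.isometry (tensorHom N K) h).isClosedEmbedding.isClosed_range
  refine closure_minimal (fun b hb => ?_) hcl (mem_wordAlg_iff.2 ha)
  have : StarAlgebra.adjoin ℂ (Set.range (word (zgen N K) : (Fin K → Fin N) → CSphere N K)) ≤
      (tensorHom N K).range := by
    refine StarAlgebra.adjoin_le ?_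
    rintro _ ⟨i, rfl⟩
    refine ⟨rcoord (i ∘ (enumZMod K).symm), ?_⟩
    change tensorHom N K (rcoord _) = _
    rw [tensorHom_rcoord]
    congr 1
    funext c
    rw [← enumZMod_apply, Function.comp_apply, Equiv.symm_apply_apply]
  exact this hb

end degreeZero

end HalfLib

/-! ### Products, adjoints and fibres in the crossed product. -/

namespace CrossedProduct

variable {G A : Type*} [Group G] [Fintype G] [DecidableEq G]

section algebraic

set_option linter.unusedSectionVars false

variable [Ring A] [StarRing A] [Algebra ℂ A] [StarModule ℂ A] {α : G →* (A →⋆ₐ[ℂ] A)}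

theorem tmul_apply (a : A) (g s : G) : tmul α a g s = if s = g then a else 0 :=
  Pi.single_apply g a s

theorem tmul_mul_apply (a : A) (g : G) (f : CrossedProduct α) (s : G) :
    (tmul α a g * f) s = a * α g (f (g⁻¹ * s)) := by
  rw [mul_apply, Finset.sum_eq_single g]
  · simp [tmul_apply]
  · intro t _ ht
    simp [tmul_apply, ht]
  · simp

theorem tmul_mul_tmul (a b : A) (g h : G) :
    tmul α a g * tmul α b h = tmul α (a * α g b) (g * h) := by
  funext s
  rw [tmul_mul_apply, tmul_apply, tmul_apply]
  simp only [inv_mul_eq_iff_eq_mul]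
  split_ifs <;> simp

theorem star_tmul (a : A) (g : G) : star (tmul α a g) = tmul α (α g⁻¹ (star a)) g⁻¹ := by
  funext s
  rw [star_apply, tmul_apply, tmul_apply]
  by_cases h : s = g⁻¹
  · subst h; simp
  · have : s⁻¹ ≠ g := fun h' => h (by rw [← h', inv_inv])
    simp [h, this]

end algebraic

section cstar

set_option linter.unusedSectionVars false

variable [CStarAlgebra A] {α : G →* (A →⋆ₐ[ℂ] A)}

/-- The embedding `a ↦ a ⊗ 1`. -/
def unitFiber (α : G →* (A →⋆ₐ[ℂ] A)) : A →⋆ₐ[ℂ] CrossedProduct α where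
  toFun a := tmul α a 1
  map_one' := rfl
  map_mul' a b := by
    refine Eq.trans ?_ (tmul_mul_tmul a b 1 1).symm
    rw [act_one, one_mul]
  map_zero' := Pi.single_zero (M := fun _ : G => A) 1
  map_add' a b := Pi.single_add (f := fun _ : G => A) 1 a b
  commutes' c := by
    rw [Algebra.algebraMap_eq_smul_one, Algebra.algebraMap_eq_smul_one]
    exact Pi.single_smul (f := fun _ : G => A) 1 c 1
  map_star' a := by
    refine Eq.trans ?_ (star_tmul a 1).symm
    rw [inv_one, act_one]

theorem unitFiber_apply (a : A) : unitFiber α a = tmul α a 1 := rfl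

theorem unitFiber_injective : Function.Injective (unitFiber α) :=
  Pi.single_injective (M := fun _ => A) 1

/-- This and the next two are the algebraic identities over a C⋆-algebra, in the form with which
later computations rewrite. -/
theorem tmul_mul_tmul_cstar (a b : A) (g h : G) :
    tmul α a g * tmul α b h = tmul α (a * α g b) (g * h) := tmul_mul_tmul a b g h

theorem star_tmul_cstar (a : A) (g : G) :
    star (tmul α a g) = tmul α (α g⁻¹ (star a)) g⁻¹ := star_tmul a g

theorem tmul_mul_apply_cstar (a : A) (g : G) (f : CrossedProduct α) (s : G) :
    (tmul α a g * f) s = a * α g (f (g⁻¹ * s)) := tmul_mul_apply a g f s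

theorem add_apply_cstar (f g : CrossedProduct α) (s : G) : (f + g) s = f s + g s := rfl

theorem sum_apply {ι : Type*} (t : Finset ι) (f : ι → CrossedProduct α) (s : G) :
    (∑ i ∈ t, f i) s = ∑ i ∈ t, f i s := by
  classical
  induction t using Finset.induction_on with
  | empty => rfl
  | insert a t ha ih => rw [Finset.sum_insert ha, Finset.sum_insert ha, add_apply_cstar, ih]

/-- The subspace of the elements `a ⊗ g`. -/
def fiber (α : G →* (A →⋆ₐ[ℂ] A)) (g : G) : Submodule ℂ (CrossedProduct α) where
  carrier := {f | ∀ s, s ≠ g → f s = 0}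
  add_mem' ha hb s hs := by
    rw [add_apply_cstar, ha s hs, hb s hs, add_zero]
  zero_mem' _ _ := rfl
  smul_mem' c f hf s hs := by
    change c • f s = 0
    rw [hf s hs, smul_zero]

theorem tmul_mul_mem_fiber (a : A) (g : G) {h : G} {f : CrossedProduct α} (hf : f ∈ fiber α h) :
    tmul α a g * f ∈ fiber α (g * h) := by
  intro s hs
  rw [tmul_mul_apply_cstar, hf, map_zero, mul_zero]
  rwa [Ne, inv_mul_eq_iff_eq_mul]

theorem unitFiber_mem_fiber (a : A) : unitFiber α a ∈ fiber α 1 := by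
  intro s hs
  rw [unitFiber_apply, tmul_apply, if_neg hs]

end cstar

end CrossedProduct

namespace HalfLib

/-! ### The representation in the crossed product -/

section representation

set_option linter.unusedSectionVars false

open CrossedProduct

variable {N K : ℕ} [NeZero K] (T : SymmetricCompact N K)

/-- The generator of `ℤ_K`. -/
abbrev tau (K : ℕ) : Multiplicative (ZMod K) := Multiplicative.ofAdd 1

/-- The element `a_{i,0} ⊗ τ`. -/
def coordTau (i : Fin N) : CrossedProduct T.action := tmul T.action (T.acoord i 0) (tau K)

theorem action_acoord (g : Multiplicative (ZMod K)) (i : Fin N) (c : ZMod K) :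
    T.action g (T.acoord i c) = T.acoord i (c + g.toAdd) := by
  ext z
  change (z.1 (c - -g.toAdd) : EuclideanSpace ℂ (Fin N)) i = _
  rw [sub_neg_eq_add]
  rfl

theorem sum_acoord_mul_star (c : ZMod K) : ∑ i, T.acoord i c * star (T.acoord i c) = 1 := by
  ext z
  have h : ‖(z.1 c : EuclideanSpace ℂ (Fin N))‖ ^ 2 = 1 := by simp
  rw [EuclideanSpace.norm_sq_eq] at h
  have h2 : ((∑ i, ‖(z.1 c : EuclideanSpace ℂ (Fin N)) i‖ ^ 2 : ℝ) : ℂ) = 1 := by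
    rw [h]; simp
  rw [ContinuousMap.sum_apply, ContinuousMap.one_apply, ← h2, Complex.ofReal_sum]
  refine Finset.sum_congr rfl fun i _ => ?_
  rw [Complex.ofReal_pow, ← Complex.mul_conj']
  rfl

theorem coordTau_mul_star (i : Fin N) :
    coordTau T i * star (coordTau T i) =
      unitFiber T.action (T.acoord i 0 * star (T.acoord i 0)) := by
  rw [coordTau, star_tmul_cstar, tmul_mul_tmul_cstar, act_act, mul_inv_cancel, act_one]
  rfl

theorem star_mul_coordTau (i : Fin N) :
    star (coordTau T i) * coordTau T i =
      unitFiber T.action (T.acoord i (-1) * star (T.acoord i (-1))) := by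
  rw [coordTau, star_tmul_cstar, tmul_mul_tmul_cstar, ← map_mul, inv_mul_cancel, mul_comm,
    map_mul, map_star (T.action _), action_acoord, zero_add]
  rfl

/-- Moving every τ to the right raises the second index of each later coordinate by one. For m = K
the power of τ disappears and the word lies in the commutative algebra C(T). -/
theorem word_coordTau {m : ℕ} (i : Fin m → Fin N) :
    word (coordTau T) i = tmul T.action (∏ c : Fin m, T.acoord (i c) ((c : ℕ) : ZMod K))
      (tau K ^ m) := by
  induction m with
  | zero => simp [word]; rfl
  | succ m ih =>
    rw [word_succ, ih, coordTau, tmul_mul_tmul_cstar, map_prod, Fin.prod_univ_succ, pow_succ']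
    simp only [action_acoord, Fin.val_zero, Nat.cast_zero, Fin.val_succ, Nat.cast_add,
      Nat.cast_one, toAdd_ofAdd]

theorem tau_pow_eq_one : tau K ^ K = 1 := by
  rw [← ofAdd_nsmul]
  simp

theorem word_coordTau_eq (i : Fin K → Fin N) :
    word (coordTau T) i =
      unitFiber T.action (∏ c : Fin K, T.acoord (i c) ((c : ℕ) : ZMod K)) := by
  rw [word_coordTau, tau_pow_eq_one]
  rfl

theorem coordTau_isHalfLiberated : IsHalfLiberated K (coordTau T) := by
  refine ⟨?_, ?_, fun i j => ?_, fun i j => ?_⟩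
  · simp only [coordTau_mul_star]
    rw [← map_sum, sum_acoord_mul_star, map_one]
  · simp only [star_mul_coordTau]
    rw [← map_sum, sum_acoord_mul_star, map_one]
  · rw [word_coordTau_eq, word_coordTau_eq, ← map_mul, ← map_mul, mul_comm]
  · rw [word_star, word_coordTau_eq, word_coordTau_eq, ← map_star (unitFiber T.action),
      ← map_mul, ← map_mul, mul_comm]

/-- The morphism `C(S^{N-1}_{ℂ,K}) → C(T) ⋊ ℤ_K` with `z_i ↦ a_{i,0} ⊗ τ`. -/
def rep : CSphere N K →⋆ₐ[ℂ] CrossedProduct T.action :=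
  (exists_lift (coordTau_isHalfLiberated T)).choose

theorem rep_zgen (i : Fin N) : rep T (zgen N K i) = coordTau T i :=
  (exists_lift (coordTau_isHalfLiberated T)).choose_spec i

/-- Pulling back functions along `T → P_u`. -/
def pullback : C(pureTensors N K, ℂ) →⋆ₐ[ℂ] C(T.carrier, ℂ) :=
  ContinuousMap.compStarAlgHom' ℂ ℂ
    ⟨fun z => pureMap z.1, continuous_pureMap.comp continuous_subtype_val⟩

theorem pullback_apply (f : C(pureTensors N K, ℂ)) (z : T.carrier) :
    pullback T f z = f (pureMap z.1) := rfl

/-- Both sides are morphisms in f, and on the coordinate r_i both give ∏_c a_{i_c, c} ⊗ 1. -/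
theorem rep_tensorHom (f : C(pureTensors N K, ℂ)) :
    rep T (tensorHom N K f) = unitFiber T.action (pullback T f) := by
  have : (rep T).comp (tensorHom N K) = (unitFiber T.action).comp (pullback T) := by
    refine tensor_hom_ext fun i => ?_
    rw [StarAlgHom.comp_apply, StarAlgHom.comp_apply, tensorHom_rcoord, map_word]
    simp only [rep_zgen]
    refine (word_coordTau_eq T _).trans (congrArg _ ?_)
    ext z
    rw [pullback_apply, pureMap_apply, ContinuousMap.prod_apply]
    exact Fintype.prod_equiv (enumZMod K) _ _ fun c => rfl
  exact congrArg (fun f' => f' f) this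

/-- The full product of spheres. -/
def fullSymmetric (N K : ℕ) : SymmetricCompact N K := ⟨Set.univ, isCompact_univ, fun _ _ _ => trivial⟩

/-- On the whole product of spheres, Φ(f) is represented by (f ∘ p) ⊗ 1, which determines f because
p is onto. -/
theorem tensorHom_injective : Function.Injective (tensorHom N K) := by
  intro f g h
  ext r
  obtain ⟨z, rfl⟩ := pureMap_surjective r
  have h1 := congrArg (rep (fullSymmetric N K)) h
  rw [rep_tensorHom, rep_tensorHom] at h1
  exact congrArg (fun f' => f' ⟨z, trivial⟩) (unitFiber_injective h1)

theorem exists_tensorHom_eq {a : CSphere N K} (ha : a ∈ gradedPart N K 0) :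
    ∃ f, tensorHom N K f = a := by
  have : a ∈ Set.range (tensorHom N K) := by
    rw [range_tensorHom tensorHom_injective]; exact ha
  exact this

theorem rep_mem_fiber_of_mem_mul {l : ℕ} {a : CSphere N K}
    (ha : a ∈ genSpan (zgen N K) ^ l * gradedPart N K 0) :
    rep T a ∈ fiber T.action (tau K ^ l) := by
  induction l generalizing a with
  | zero =>
    rw [pow_zero, one_mul] at ha
    obtain ⟨f, rfl⟩ := exists_tensorHom_eq ha
    rw [rep_tensorHom, pow_zero]
    exact unitFiber_mem_fiber _
  | succ l ih =>
    rw [pow_succ', mul_assoc] at ha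
    induction ha using Submodule.mul_induction_on' with
    | mem_mul_mem x hx y hy =>
      rw [map_mul, pow_succ']
      induction hx using Submodule.span_induction with
      | zero => rw [map_zero, zero_mul]; exact zero_mem _
      | add u v _ _ hu hv => rw [map_add, add_mul]; exact add_mem hu hv
      | smul c u _ hu => rw [map_smul, smul_mul_assoc]; exact Submodule.smul_mem _ c hu
      | mem u hu =>
        obtain ⟨i, rfl⟩ := hu
        rw [rep_zgen]
        exact tmul_mul_mem_fiber _ _ (ih hy)
    | add x _ y _ hx hy => rw [map_add]; exact add_mem hx hy

/-- Since A_l ⊆ Z^l A_0, it suffices that each generator goes to the fibre over τ and A_0 to the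
fibre over 1. -/
theorem rep_mem_fiber {l : ℕ} {a : CSphere N K} (ha : a ∈ gradedPart N K l) :
    rep T a ∈ fiber T.action (tau K ^ l) := by
  refine rep_mem_fiber_of_mem_mul T ?_
  have h : genSpan (fun k => star (zgen N K k)) ^ l * Submodule.span ℂ {a} ≤ gradedPart N K 0 := by
    refine le_trans ?_ (star_genSpan_pow_mul_le l)
    gcongr
    exact (Submodule.span_singleton_le_iff_mem _ _).2 ha
  exact mul_le_mul' (le_refl (genSpan (zgen N K) ^ l)) h (mem_genSpan_pow_mul l a)

theorem tau_pow_injOn {l m : ℕ} (hl : l < K) (hm : m < K) (h : tau K ^ l = tau K ^ m) :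
    l = m := by
  rw [← ofAdd_nsmul, ← ofAdd_nsmul] at h
  have h1 := Multiplicative.ofAdd.injective h
  rw [nsmul_one, nsmul_one] at h1
  have h2 := congrArg ZMod.val h1
  rwa [ZMod.val_cast_of_lt hl, ZMod.val_cast_of_lt hm] at h2

/-- The components of a of degrees 0, …, K - 1 go to fibres over distinct powers of τ, so they
vanish separately. This replaces K-symmetry for the representation. -/
theorem rep_proj_eq_zero {a : CSphere N K} (ha : rep T a = 0) {l : ℕ} (hl : l < K) :
    rep T (proj l a) = 0 := by
  funext s
  by_cases hs : s = tau K ^ l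
  · subst hs
    have h1 : (rep T (∑ m ∈ Finset.range K, proj m a)) (tau K ^ l) = 0 := by
      rw [sum_proj, ha]; rfl
    rw [map_sum, CrossedProduct.sum_apply, Finset.sum_eq_single l] at h1
    · exact h1
    · intro m hm hml
      refine rep_mem_fiber T (proj_mem_gradedPart m a) _ fun h => hml ?_
      exact (tau_pow_injOn hl (Finset.mem_range.1 hm) h).symm
    · intro h; exact absurd (Finset.mem_range.2 hl) h
  · exact rep_mem_fiber T (proj_mem_gradedPart l a) s hs

end representation

end HalfLib

namespace HalfLib

/-! ### Kernels of symmetric morphisms -/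

section kernels

variable {N K : ℕ} [NeZero K] {B : Type*} [CStarAlgebra B]

/-- The degree zero part of the kernel of a morphism. -/
def kerZero (f : CSphere N K →⋆ₐ[ℂ] B) : Submodule ℂ (CSphere N K) :=
  LinearMap.ker f.toAlgHom.toLinearMap ⊓ gradedPart N K 0

theorem mem_kerZero {f : CSphere N K →⋆ₐ[ℂ] B} {a : CSphere N K} :
    a ∈ kerZero f ↔ f a = 0 ∧ a ∈ gradedPart N K 0 := Iff.rfl

theorem isClosed_kerZero (f : CSphere N K →⋆ₐ[ℂ] B) : IsClosed (kerZero f : Set (CSphere N K)) :=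
  (isClosed_eq (continuous_starAlgHom f) continuous_const).inter (isClosed_gradedPart 0)

theorem gammaMap_mem_gradedPart {a : CSphere N K} (ha : a ∈ gradedPart N K 0) :
    gammaMap a ∈ gradedPart N K 0 := by
  refine Submodule.sum_mem _ fun i _ => ?_
  have h1 := gradedPart_mul_le 1 0
    (Submodule.mul_mem_mul (genSpan_le_gradedPart (mem_genSpan (zgen N K) i)) ha)
  have h2 := gradedPart_mul_le _ _ (Submodule.mul_mem_mul h1 (star_genSpan_le_gradedPart
    (mem_genSpan (fun k => star (zgen N K k)) i)))
  have h3 := gradedPart_mul_K (N := N) (K := K) 1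
  rw [one_mul] at h3
  rwa [add_zero, Nat.add_sub_cancel' (NeZero.pos K), h3] at h2

theorem kerZero_isGammaStableIdeal (f : CSphere N K →⋆ₐ[ℂ] B) :
    IsGammaStableIdeal (kerZero f) where
  le := inf_le_right
  mul_mem_left a ha b hb := by
    rw [mem_kerZero] at hb ⊢
    refine ⟨by rw [map_mul, hb.1, mul_zero], ?_⟩
    exact gradedPart_mul_le 0 0 (Submodule.mul_mem_mul ha hb.2)
  mul_mem_right a ha b hb := by
    rw [mem_kerZero] at hb ⊢
    refine ⟨by rw [map_mul, hb.1, zero_mul], ?_⟩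
    exact gradedPart_mul_le 0 0 (Submodule.mul_mem_mul hb.2 ha)
  gamma_mem b hb := by
    rw [mem_kerZero] at hb ⊢
    refine ⟨?_, gammaMap_mem_gradedPart hb.2⟩
    rw [gammaMap, map_sum]
    exact Finset.sum_eq_zero fun i _ => by rw [map_mul, map_mul, hb.1, mul_zero, zero_mul]

/-- Write a ∈ Z^l (S^l a): the factor S^l a has degree zero and stays in the kernel. -/
theorem mem_gradedPart_mul_kerZero {f : CSphere N K →⋆ₐ[ℂ] B} {l : ℕ} {a : CSphere N K}
    (ha : a ∈ gradedPart N K l) (hf : f a = 0) : a ∈ gradedPart N K l * kerZero f := by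
  have h : genSpan (fun k => star (zgen N K k)) ^ l * Submodule.span ℂ {a} ≤ kerZero f := by
    refine le_inf ?_ ?_
    · refine Submodule.mul_le.2 fun s _ b hb => ?_
      obtain ⟨c, rfl⟩ := Submodule.mem_span_singleton.1 hb
      change f (s * c • a) = 0
      rw [map_mul, map_smul, hf, smul_zero, mul_zero]
    · refine le_trans ?_ (star_genSpan_pow_mul_le l)
      gcongr
      exact (Submodule.span_singleton_le_iff_mem _ _).2 ha
  exact mul_le_mul' (genSpan_pow_le_gradedPart l) h (mem_genSpan_pow_mul l a)

/-- A kernel stable under the projections is determined by its degree zero part. It is applied both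
to q and to the representation, whose kernels are then compared in degree zero only. -/
theorem eq_zero_iff_mem_sup {f : CSphere N K →⋆ₐ[ℂ] B}
    (hf : ∀ a, f a = 0 → ∀ l < K, f (proj l a) = 0) (a : CSphere N K) :
    f a = 0 ↔ a ∈ kerZero f ⊔ ⨆ l ∈ Finset.Ico 1 K, gradedPart N K l * kerZero f := by
  constructor
  · intro ha
    rw [← sum_proj a]
    refine Submodule.sum_mem _ fun l hl => ?_
    have hl' := Finset.mem_range.1 hl
    rcases Nat.eq_zero_or_pos l with rfl | h0
    · exact le_sup_left (α := Submodule ℂ (CSphere N K))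
        (mem_kerZero.2 ⟨hf a ha 0 hl', proj_mem_gradedPart 0 a⟩)
    · refine le_sup_right (α := Submodule ℂ (CSphere N K)) ?_
      exact le_iSup₂ (f := fun l (_ : l ∈ Finset.Ico 1 K) => gradedPart N K l * kerZero f) l
        (Finset.mem_Ico.2 ⟨h0, hl'⟩)
        (mem_gradedPart_mul_kerZero (proj_mem_gradedPart l a) (hf a ha l hl'))
  · have : kerZero f ⊔ ⨆ l ∈ Finset.Ico 1 K, gradedPart N K l * kerZero f ≤
        LinearMap.ker f.toAlgHom.toLinearMap := by
      refine sup_le inf_le_left (iSup₂_le fun l _ => Submodule.mul_le.2 fun x _ y hy => ?_)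
      change f (x * y) = 0
      rw [map_mul, (mem_kerZero.1 hy).1, mul_zero]
    exact fun ha => this ha

theorem IsKSymmetric.map_proj {q : CSphere N K →⋆ₐ[ℂ] B} (h : IsKSymmetric q) {a : CSphere N K}
    (ha : q a = 0) (l : ℕ) : q (proj l a) = 0 := by
  obtain ⟨α, hα⟩ := h
  rw [proj, map_smul, map_sum, Finset.sum_eq_zero, smul_zero]
  intro ω _
  rw [map_smul, ← hα, ha, map_zero, smul_zero]

theorem isCutOutBy_kerZero {q : CSphere N K →⋆ₐ[ℂ] B} (h : IsKSymmetric q) :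
    IsCutOutBy q (kerZero q) := by
  have hmem := eq_zero_iff_mem_sup (f := q) fun a ha l _ => h.map_proj ha l
  refine ⟨kerZero_isGammaStableIdeal q, le_antisymm ?_ ?_, hmem⟩
  · intro a ha
    set I := TwoSidedIdeal.span (kerZero q : Set (CSphere N K))
    have hI : ∀ b ∈ kerZero q, b ∈ I := fun b hb => TwoSidedIdeal.subset_span hb
    have : kerZero q ⊔ ⨆ l ∈ Finset.Ico 1 K, gradedPart N K l * kerZero q ≤
        (TwoSidedIdeal.asIdeal I).restrictScalars ℂ := by
      refine sup_le (fun b hb => ?_) (iSup₂_le fun l _ => Submodule.mul_le.2 fun x _ y hy => ?_)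
      · exact TwoSidedIdeal.mem_asIdeal.2 (hI b hb)
      · exact TwoSidedIdeal.mem_asIdeal.2 (I.mul_mem_left _ _ (hI y hy))
    exact TwoSidedIdeal.mem_asIdeal.1 (this ((hmem a).1 ((TwoSidedIdeal.mem_ker q).1 ha)))
  · rw [TwoSidedIdeal.span_le]
    exact fun a ha => (TwoSidedIdeal.mem_ker q).2 ha.1

/-- Projecting the decomposition J + A_1 J + ⋯ + A_{K-1} J to degree zero leaves only J, so J is
determined by q. -/
theorem IsCutOutBy.eq_kerZero {q : CSphere N K →⋆ₐ[ℂ] B} {J : Submodule ℂ (CSphere N K)}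
    (h : IsCutOutBy q J) : J = kerZero q := by
  refine le_antisymm (fun a ha => mem_kerZero.2 ⟨?_, h.ideal.le ha⟩) fun a ha => ?_
  · exact (h.mem_ker_iff a).2 (le_sup_left (α := Submodule ℂ (CSphere N K)) ha)
  · rw [mem_kerZero] at ha
    -- The elements whose degree zero component lies in J; it contains J and each A_l J with 0 < l <
    -- K.
    let S : Submodule ℂ (CSphere N K) :=
      { carrier := {b | proj 0 b ∈ J}
        add_mem' := fun {x y} hx hy => by
          rw [Set.mem_ofPred_eq, proj_add]; exact add_mem hx hy
        zero_mem' := by simp [proj]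
        smul_mem' := fun c x hx => by
          have : proj 0 (c • x) = c • proj 0 x := by
            simp only [proj, map_smul, Finset.smul_sum, smul_comm _ c]
          rw [Set.mem_ofPred_eq, this]; exact J.smul_mem c hx }
    have : J ⊔ ⨆ l ∈ Finset.Ico 1 K, gradedPart N K l * J ≤ S := by
      refine sup_le (fun b hb => ?_) (iSup₂_le fun l hl b hb => ?_)
      · change proj 0 b ∈ J
        rwa [proj_of_mem (h.ideal.le hb)]
      · change proj 0 b ∈ J
        obtain ⟨h1, h2⟩ := Finset.mem_Ico.1 hl
        have hb' : b ∈ gradedPart N K l :=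
          gradedPart_mul_le l 0 (mul_le_mul' le_rfl h.ideal.le hb)
        rw [proj_zero_of_mem (Nat.one_le_iff_ne_zero.1 h1) h2 hb']
        exact zero_mem _
    have hS : proj 0 a ∈ J := this ((h.mem_ker_iff a).1 ha.1)
    rwa [proj_of_mem ha.2] at hS

/-- A morphism vanishing on the kernel of a surjective morphism factors through it. -/
def factor {A C : Type*} [CStarAlgebra A] [CStarAlgebra C] (q : A →⋆ₐ[ℂ] B)
    (hq : Function.Surjective q) (f : A →⋆ₐ[ℂ] C) (h : ∀ a, q a = 0 → f a = 0) : B →⋆ₐ[ℂ] C :=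
  have key : ∀ a b, q a = q b → f a = f b := fun a b hab => by
    rw [← sub_eq_zero, ← map_sub]
    exact h _ (by rw [map_sub, hab, sub_self])
  have hs := Function.surjInv_eq hq
  { toFun := fun b => f (Function.surjInv hq b)
    map_one' := by rw [← map_one f]; exact key _ _ (by rw [hs, map_one])
    map_mul' := fun x y => by rw [← map_mul]; exact key _ _ (by rw [map_mul, hs, hs, hs])
    map_zero' := by rw [← map_zero f]; exact key _ _ (by rw [hs, map_zero])
    map_add' := fun x y => by rw [← map_add]; exact key _ _ (by rw [map_add, hs, hs, hs])
    commutes' := fun c => by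
      rw [← AlgHomClass.commutes f c]; exact key _ _ (by rw [hs, AlgHomClass.commutes])
    map_star' := fun x => by rw [← map_star f]; exact key _ _ (by rw [map_star q, hs, hs]) }

theorem factor_apply {A C : Type*} [CStarAlgebra A] [CStarAlgebra C] (q : A →⋆ₐ[ℂ] B)
    (hq : Function.Surjective q) (f : A →⋆ₐ[ℂ] C) (h : ∀ a, q a = 0 → f a = 0) (a : A) :
    factor q hq f h (q a) = f a := by
  change f (Function.surjInv hq (q a)) = f a
  rw [← sub_eq_zero, ← map_sub]
  exact h _ (by rw [map_sub, Function.surjInv_eq hq, sub_self])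

end kernels

/-! ### Symmetry of the zero set of a `γ`-stable ideal -/

section symmetry

open CrossedProduct

variable {N K : ℕ}

theorem shift_add (j k : ZMod K) (z : SphereProd N K) : shift (j + k) z = shift j (shift k z) := by
  funext c
  exact congrArg z (by abel)

variable [NeZero K]

/-- Conjugation by a_{i0} ⊗ τ applies τ and multiplies by |a_{i0}|^2, and these factors sum to 1. -/
theorem rep_gammaMap (T : SymmetricCompact N K) (f : C(pureTensors N K, ℂ)) :
    rep T (gammaMap (tensorHom N K f)) =
      unitFiber T.action (T.action (tau K) (pullback T f)) := by
  have h : ∀ i, rep T (zgen N K i * tensorHom N K f * star (zgen N K i)) =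
      unitFiber T.action
        (T.acoord i 0 * star (T.acoord i 0) * T.action (tau K) (pullback T f)) := by
    intro i
    rw [map_mul, map_mul, map_star (rep T), rep_tensorHom, rep_zgen, coordTau, star_tmul_cstar,
      unitFiber_apply, tmul_mul_tmul_cstar, tmul_mul_tmul_cstar, mul_one, act_act,
      mul_inv_cancel, act_one, mul_right_comm]
    rfl
  rw [gammaMap, map_sum]
  simp only [h]
  rw [← map_sum, ← Finset.sum_mul, sum_acoord_mul_star, one_mul]

theorem apply_pureMap_of_gammaMap_eq {f g : C(pureTensors N K, ℂ)}
    (h : gammaMap (tensorHom N K f) = tensorHom N K g) (z : SphereProd N K) :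
    g (pureMap z) = f (pureMap (shift (-1) z)) := by
  have h1 := congrArg (rep (fullSymmetric N K)) h
  rw [rep_gammaMap, rep_tensorHom] at h1
  exact (congrArg (fun f' => f' ⟨z, trivial⟩) (unitFiber_injective h1)).symm

/-- The ideal of `C(P_u)` corresponding to a `γ`-stable ideal. -/
def functionIdeal {J : Submodule ℂ (CSphere N K)} (hJ : IsGammaStableIdeal J) :
    Ideal C(pureTensors N K, ℂ) where
  carrier := {f | tensorHom N K f ∈ J}
  add_mem' {f g} hf hg := by
    rw [Set.mem_ofPred_eq, map_add]; exact add_mem hf hg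
  zero_mem' := by rw [Set.mem_ofPred_eq, map_zero]; exact zero_mem _
  smul_mem' f g hg := by
    rw [Set.mem_ofPred_eq, smul_eq_mul, map_mul]
    exact hJ.mul_mem_left _ (tensorHom_mem f) _ hg

theorem mem_functionIdeal {J : Submodule ℂ (CSphere N K)} (hJ : IsGammaStableIdeal J)
    {f : C(pureTensors N K, ℂ)} : f ∈ functionIdeal hJ ↔ tensorHom N K f ∈ J := Iff.rfl

/-- The common zeros of the functions corresponding to a `γ`-stable ideal. -/
def zeroSet {J : Submodule ℂ (CSphere N K)} (hJ : IsGammaStableIdeal J) :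
    Set (pureTensors N K) :=
  (ContinuousMap.setOfIdeal (functionIdeal hJ))ᶜ

variable {J : Submodule ℂ (CSphere N K)} (hJ : IsGammaStableIdeal J)

theorem mem_zeroSet {r : pureTensors N K} :
    r ∈ zeroSet hJ ↔ ∀ f, tensorHom N K f ∈ J → f r = 0 :=
  ContinuousMap.notMem_setOfIdeal

theorem isClosed_zeroSet : IsClosed (zeroSet hJ) :=
  (ContinuousMap.setOfIdeal_open (functionIdeal hJ)).isClosed_compl

/-- A closed ideal of C(P_u) consists of all functions vanishing on its zero set; this is where
closedness of J enters. -/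
theorem tensorHom_mem_iff (hcl : IsClosed (J : Set (CSphere N K))) (f : C(pureTensors N K, ℂ)) :
    tensorHom N K f ∈ J ↔ ∀ r ∈ zeroSet hJ, f r = 0 := by
  have hI : IsClosed (functionIdeal hJ : Set C(pureTensors N K, ℂ)) :=
    hcl.preimage (continuous_starAlgHom (tensorHom N K))
  rw [← mem_functionIdeal hJ, ← ContinuousMap.idealOfSet_ofIdeal_isClosed hI,
    ContinuousMap.mem_idealOfSet]
  rfl

/-- γ-stability gives invariance under the shift by -1 only; iterating it reaches every j because
ℤ_K is finite cyclic. -/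
theorem shift_mem_zeroSet (j : ZMod K) {z : SphereProd N K} (hz : pureMap z ∈ zeroSet hJ) :
    pureMap (shift j z) ∈ zeroSet hJ := by
  have h1 : ∀ w : SphereProd N K, pureMap w ∈ zeroSet hJ →
      pureMap (shift (-1) w) ∈ zeroSet hJ := by
    intro w hw
    rw [mem_zeroSet] at hw ⊢
    intro f hf
    have hγ := hJ.gamma_mem _ hf
    obtain ⟨g, hg⟩ := exists_tensorHom_eq (hJ.le hγ)
    rw [← apply_pureMap_of_gammaMap_eq hg.symm]
    exact hw g (by rwa [hg])
  have h2 : ∀ n : ℕ, pureMap (shift (-(n : ZMod K)) z) ∈ zeroSet hJ := by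
    intro n
    induction n with
    | zero =>
      have : shift (-((0 : ℕ) : ZMod K)) z = z := by
        funext c
        exact congrArg z (by simp)
      rwa [this]
    | succ n ih =>
      have := h1 _ ih
      rwa [← shift_add, ← neg_add, add_comm, ← Nat.cast_succ] at this
  have := h2 (-j).val
  rwa [ZMod.natCast_zmod_val, neg_neg] at this

theorem isSymmetric_zeroSet : IsSymmetricTensorSet (zeroSet hJ) := by
  intro r hr s hs
  obtain ⟨z, rfl⟩ := pureMap_surjective r
  have : s = pureMap (shift 1 z) := Subtype.ext (hs.trans (cyc_pureMap z))
  rw [this]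
  exact shift_mem_zeroSet hJ 1 hr

/-- The preimage of the zero set in the product of spheres. -/
def zeroPreimage : SymmetricCompact N K where
  carrier := pureMap ⁻¹' zeroSet hJ
  isCompact := ((isClosed_zeroSet hJ).preimage continuous_pureMap).isCompact
  shift_mem j _ hz := shift_mem_zeroSet hJ j hz

/-- Φ(f) is represented by zero exactly when f ∘ p vanishes on p^{-1}(T_0), that is, when f vanishes
on T_0, as p is onto. -/
theorem kerZero_rep (hcl : IsClosed (J : Set (CSphere N K))) :
    kerZero (rep (zeroPreimage hJ)) = J := by
  have key : ∀ f, rep (zeroPreimage hJ) (tensorHom N K f) = 0 ↔ tensorHom N K f ∈ J := by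
    intro f
    rw [tensorHom_mem_iff hJ hcl, rep_tensorHom, map_eq_zero_iff _ unitFiber_injective]
    constructor
    · intro h r hr
      obtain ⟨z, rfl⟩ := pureMap_surjective r
      exact congrArg (fun f' => f' (⟨z, hr⟩ : (zeroPreimage hJ).carrier)) h
    · intro h
      ext z
      exact h _ z.2
  ext a
  rw [mem_kerZero]
  constructor
  · rintro ⟨h1, h2⟩
    obtain ⟨f, rfl⟩ := exists_tensorHom_eq h2
    exact (key f).1 h1
  · intro ha
    have h2 := hJ.le ha
    obtain ⟨f, rfl⟩ := exists_tensorHom_eq h2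
    exact ⟨(key f).2 ha, h2⟩

end symmetry

end HalfLib
end

/-! ### The theorem: comparison of the kernels of q and of the representation. -/

theorem theorem6p7 (N K : ℕ) [NeZero K] {B : Type*} [CStarAlgebra B]
    (q : HalfLib.CSphere N K →⋆ₐ[ℂ] B) (hq : Function.Surjective q)
    (hsym : HalfLib.IsKSymmetric q) :
    ∃ Φ : C(HalfLib.pureTensors N K, ℂ) →⋆ₐ[ℂ] HalfLib.CSphere N K,
      (∀ i : ZMod K → Fin N,
        Φ (HalfLib.rcoord i) =
          HalfLib.word (HalfLib.zgen N K) (fun c : Fin K => i ((c : ℕ) : ZMod K))) ∧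
      Function.Injective Φ ∧
      Set.range Φ = (HalfLib.gradedPart N K 0 : Set (HalfLib.CSphere N K)) ∧
      (∃ J : Submodule ℂ (HalfLib.CSphere N K), HalfLib.IsCutOutBy q J) ∧
      ∀ J : Submodule ℂ (HalfLib.CSphere N K), HalfLib.IsCutOutBy q J →
        ∃ T₀ : Set (HalfLib.pureTensors N K),
          IsCompact T₀ ∧ HalfLib.IsSymmetricTensorSet T₀ ∧
          (∀ f : C(HalfLib.pureTensors N K, ℂ), Φ f ∈ J ↔ ∀ r ∈ T₀, f r = 0) ∧
          ∃ T : HalfLib.SymmetricCompact N K,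
            T.carrier = HalfLib.pureMap ⁻¹' T₀ ∧
            ∃ ρ : B →⋆ₐ[ℂ] CrossedProduct T.action,
              Function.Injective ρ ∧
              ∀ i : Fin N, ρ (q (HalfLib.zgen N K i)) =
                CrossedProduct.tmul T.action (T.acoord i 0) (Multiplicative.ofAdd (1 : ZMod K)) := by
  refine ⟨HalfLib.tensorHom N K, HalfLib.tensorHom_rcoord, HalfLib.tensorHom_injective,
    HalfLib.range_tensorHom HalfLib.tensorHom_injective, ⟨_, HalfLib.isCutOutBy_kerZero hsym⟩,
    fun J h => ?_⟩
  -- Ideals are not assumed closed; J is closed because it is the degree zero part of the kernel of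
  -- q.
  have hcl : IsClosed (J : Set (HalfLib.CSphere N K)) := by
    rw [h.eq_kerZero]; exact HalfLib.isClosed_kerZero q
  -- Both kernels equal J + A_1 J + ⋯ + A_{K-1} J.
  have hker : ∀ a, HalfLib.rep (HalfLib.zeroPreimage h.ideal) a = 0 ↔ q a = 0 := fun a => by
    rw [h.mem_ker_iff, HalfLib.eq_zero_iff_mem_sup fun a ha l hl =>
      HalfLib.rep_proj_eq_zero (HalfLib.zeroPreimage h.ideal) ha hl,
      HalfLib.kerZero_rep h.ideal hcl]
  refine ⟨HalfLib.zeroSet h.ideal, (HalfLib.isClosed_zeroSet h.ideal).isCompact,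
    HalfLib.isSymmetric_zeroSet h.ideal, HalfLib.tensorHom_mem_iff h.ideal hcl,
    HalfLib.zeroPreimage h.ideal, rfl,
    HalfLib.factor q hq (HalfLib.rep _) fun a ha => (hker a).2 ha, ?_, fun i => ?_⟩
  · rw [injective_iff_map_eq_zero]
    intro b hb
    obtain ⟨a, rfl⟩ := hq b
    rw [HalfLib.factor_apply] at hb
    exact (hker a).1 hb
  · rw [HalfLib.factor_apply]
    exact HalfLib.rep_zgen _ i
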